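/- **Theorem 1.** Let $p,q\ge 0$ be integers, let $x\in\mathbb R^p$, $y\in\mathbb R^q$ be random vectors, and let $(X_1,Y_1),\dots,(X_n,Y_n)$ be independent copies of $(x,y)$. Write $\angle(u,v,w)=\arccos\frac{(u-w)^\top(v-w)}{\|u-w\|\,\|v-w\|}$, with the convention $0/0=0$. *Population quantities.* For real random variables $U,V$ with joint and marginal distribution functions $F_{U,V},F_U,F_V$, put $D(U,V)=\int (F_{U,V}-F_UF_V)^2\,dF_{U,V}$. The squared projection covariance is $$\mathrm{Pcov}(x,y)^2=\iint D(\alpha^\top x,\beta^\top y)\,d\alpha\,d\beta ,$$ where $\alpha,\beta$ run over the unit spheres of $\mathbb R^p,\mathbb R^q$, and $d\alpha$, $d\beta$ are the rotation invariant measures of total mass $2\pi$. For arbitrary laws one uses its explicit form (equal to the integral when the laws of $x$ and $y$ have no atoms): with $(x_1,y_1),\dots,(x_5,y_5)$ independent copies of $(x,y)$, $$\mathrm{Pcov}_*(x,y)^2=\mathrm E[\angle(x_1,x_4,x_3)\angle(y_1,y_4,y_3)]+\mathrm E[\angle(x_1,x_4,x_3)\angle(y_2,y_5,y_3)]-2\,\mathrm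 E[\angle(x_1,x_4,x_3)\angle(y_2,y_4,y_3)].$$ The squared projection correlation is $\mathrm{PC}(x,y)^2=\mathrm{Pcov}(x,y)^2/\big(\mathrm{Pcov}(x,x)\,\mathrm{Pcov}(y,y)\big)$, with $0/0=0$, where $\mathrm{Pcov}(x,x)$ is the nonnegative square root of $\mathrm{Pcov}(x,x)^2$; $\mathrm{PC}_*$ is defined from $\mathrm{Pcov}_*$ in the same way. *Sample quantities.* Let $a_{klr}=\angle(X_k,X_l,X_r)$ if $k\ne r$ and $l\ne r$, and $a_{klr}=0$ otherwise; let $A_{klr}=a_{klr}-\frac1n\sum_{l'}a_{kl'r}-\frac1n\sum_{k'}a_{k'lr}+\frac1{n^2}\sum_{k',l'}a_{k'l'r}$; define $b_{klr},B_{klr}$ likewise from $Y_1,\dots,Y_n$. Put $\widehat{\mathrm{Pcov}}(X,Y)^2=n^{-3}\sum_{k,l,r}A_{klr}B_{klr}$, $\widehat{\mathrm{Pcov}}(X,X)^2=n^{-3}\sum_{k,l,r} A_{klr}^2$, $\widehat{\mathrm{Pcov}}(Y,Y)^2=n^{-3}\sum_{k,l,r} B_{klr}^2$, and $\widehat{\mathrm{PC}}(X,Y)^2=\widehat{\mathrm{Pcov}}(X,Y)^2/\big(\widehat{\mathrm{Pcov}}(X,X)\,\widehat{\mathrm{Pcov}}(Y,Y)\big)$,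 with $0/0=0$. *Claim.* There are absolute constants $c_1,c_2>0$, which depend neither on $p,q,n,\varepsilon$ nor on the distribution of $(x,y)$, such that for all $0<\varepsilon<1$ and $n\ge 10\pi^2/\varepsilon$: (i) if the laws of $x$ and of $y$ are continuous, i.e. $\Pr(x=a)=0$ and $\Pr(y=b)=0$ for all $a\in\mathbb R^p$, $b\in\mathbb R^q$, then $$\Pr\big\{|\widehat{\mathrm{Pcov}}(X,Y)^2-\mathrm{Pcov}(x,y)^2|>\varepsilon\big\}\le c_1\exp(-c_2n\varepsilon^2),$$ $$\Pr\big\{|\widehat{\mathrm{PC}}(X,Y)^2-\mathrm{PC}(x,y)^2|>\varepsilon\big\}\le 5c_1\exp(-c_2\sigma n\varepsilon^2),$$ where $\sigma=\min\Big\{\frac{\sigma_x^3\sigma_y^3}{4M^4},\frac{\sigma_x^2\sigma_y^2}{4M^4}\Big\}$, $\sigma_x=\mathrm{Pcov}(x,x)^2$, $\sigma_y=\mathrm{Pcov}(y,y)^2$ and $M=4\pi^2$; (ii) for an arbitrary joint law of $(x,y)$ the same two inequalities hold with $\mathrm{Pcov}_*$ and $\mathrm{PC}_*$ in place of $\mathrm{Pcov}$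 and $\mathrm{PC}$ (also in $\sigma_x$, $\sigma_y$). No moment condition is imposed. -/

import Mathlib

open MeasureTheory ProbabilityTheory

noncomputable section

namespace ProjCorr

/-- `ℝᵖ` with its Euclidean norm. -/
abbrev E (p : ℕ) : Type := EuclideanSpace ℝ (Fin p)

/-- The rotation invariant measure `dα` on the unit sphere of `ℝᵖ`: the surface measure, rescaled
to total mass `2π` (for `p ≥ 1`), so that
`∫ I(αᵀu ≤ 0) I(αᵀv ≤ 0) dα = π - arccos (uᵀv / (‖u‖ ‖v‖))` for nonzero `u`, `v`. -/
def sphereMeasure (p : ℕ) : Measure (Metric.sphere (0 : E p) 1) :=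
  (ENNReal.ofReal (2 * Real.pi) * ((volume : Measure (E p)).toSphere Set.univ)⁻¹) •
    (volume : Measure (E p)).toSphere

section Population

variable {Ω : Type*} [MeasurableSpace Ω]

/-- Distribution function of a real random variable. -/
def distFun (P : Measure Ω) (U : Ω → ℝ) (u : ℝ) : ℝ :=
  P.real {ω | U ω ≤ u}

/-- Joint distribution function of a pair of real random variables. -/
def jointDistFun (P : Measure Ω) (U V : Ω → ℝ) (u v : ℝ) : ℝ :=
  P.real {ω | U ω ≤ u ∧ V ω ≤ v}

/-- The integral `∫ (F_{U,V}(u, v) - F_U(u) F_V(v))² dF_{U,V}(u, v)`. -/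
def cvmDependence (P : Measure Ω) (U V : Ω → ℝ) : ℝ :=
  ∫ w : ℝ × ℝ, (jointDistFun P U V w.1 w.2 - distFun P U w.1 * distFun P V w.2) ^ 2
    ∂(P.map fun ω => (U ω, V ω))

/-- The squared projection covariance: the integral of the above over all pairs of directions,
with `U = αᵀx` and `V = βᵀy`. -/
def pcovSq {p q : ℕ} (P : Measure Ω) (x : Ω → E p) (y : Ω → E q) : ℝ :=
  ∫ α, ∫ β, cvmDependence P (fun ω => inner ℝ (α : E p) (x ω)) (fun ω => inner ℝ (β : E q) (y ω))
    ∂(sphereMeasure q) ∂(sphereMeasure p)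

/-- `arccos {(u - w)ᵀ (v - w) / (‖u - w‖ ‖v - w‖)}`, with `0 / 0 = 0`. -/
def arccosAngle {p : ℕ} (u v w : E p) : ℝ :=
  Real.arccos (inner ℝ (u - w) (v - w) / (‖u - w‖ * ‖v - w‖))

/-- The explicit form `S₁ + S₂ - 2 S₃` of the squared projection covariance, an expectation over
five independent copies of `(x, y)`; the copies `1, …, 5` are `ω 0, …, ω 4`. -/
def pcovSqExplicit {p q : ℕ} (P : Measure Ω) (x : Ω → E p) (y : Ω → E q) : ℝ :=
  (∫ ω : Fin 5 → Ω, arccosAngle (x (ω 0)) (x (ω 3)) (x (ω 2)) *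
      arccosAngle (y (ω 0)) (y (ω 3)) (y (ω 2)) ∂(Measure.pi fun _ => P)) +
  (∫ ω : Fin 5 → Ω, arccosAngle (x (ω 0)) (x (ω 3)) (x (ω 2)) *
      arccosAngle (y (ω 1)) (y (ω 4)) (y (ω 2)) ∂(Measure.pi fun _ => P)) -
  2 * (∫ ω : Fin 5 → Ω, arccosAngle (x (ω 0)) (x (ω 3)) (x (ω 2)) *
      arccosAngle (y (ω 1)) (y (ω 3)) (y (ω 2)) ∂(Measure.pi fun _ => P))

end Population

section Sample

variable {n p q : ℕ}

/-- `a_{klr}`. -/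
def sampleAngle (X : Fin n → E p) (k l r : Fin n) : ℝ :=
  if k = r ∨ l = r then 0 else arccosAngle (X k) (X l) (X r)

/-- `A_{klr}`, the doubly centered version of `a_{klr}`. -/
def sampleCentered (X : Fin n → E p) (k l r : Fin n) : ℝ :=
  sampleAngle X k l r - (n : ℝ)⁻¹ * ∑ l' : Fin n, sampleAngle X k l' r
    - (n : ℝ)⁻¹ * ∑ k' : Fin n, sampleAngle X k' l r
    + ((n : ℝ) ^ 2)⁻¹ * ∑ k' : Fin n, ∑ l' : Fin n, sampleAngle X k' l' r

/-- The squared sample projection covariance `n⁻³ ∑ A_{klr} B_{klr}`. -/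
def samplePcovSq (X : Fin n → E p) (Y : Fin n → E q) : ℝ :=
  ((n : ℝ) ^ 3)⁻¹ * ∑ k : Fin n, ∑ l : Fin n, ∑ r : Fin n,
    sampleCentered X k l r * sampleCentered Y k l r

end Sample

/-- The squared correlation from the squared covariance `v = Pcov(x, y)²` and the squared
variances `vx = Pcov(x, x)²`, `vy = Pcov(y, y)²`, namely
`Pcov(x, y)² / (Pcov(x, x) Pcov(y, y))`, with `0 / 0 = 0`. -/
def corrSq (v vx vy : ℝ) : ℝ := v / (√vx * √vy)

/-- The constant `M = 4π²`. -/
def M : ℝ := 4 * Real.pi ^ 2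

/-- `σ = min {σ_x³ σ_y³ / (4 M⁴), σ_x² σ_y² / (4 M⁴)}`. -/
def sigma (sx sy : ℝ) : ℝ :=
  min (sx ^ 3 * sy ^ 3 / (4 * M ^ 4)) (sx ^ 2 * sy ^ 2 / (4 * M ^ 4))

end ProjCorr

end

/-! Everything rests on boundedness. Expanding the double centering of symmetric arrays turns n⁻³ ∑
A B into a `V`-statistic of order five (`samplePcovSq_eq_sum`). Its kernel a(b₁ + b₂ - 2b₃) is built
from angles in [0, π], so it is at most M = 4π² in absolute value, and its mean over five
independent copies is Pcov_*². Replacing one observation moves the average by at most 10M/n, so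
McDiarmid's inequality controls the fluctuation. Index tuples without repetition have exactly the
right mean, so the bias is at most 40M/n. When nε is too small to absorb the bias, the claimed bound
exceeds 1 or the event is empty (`IsVTerm.measureReal_abs_sub_gt_le`). No moments enter, and the
constants see neither the dimension nor the law.

For the correlation, the sample Cauchy-Schwarz inequality keeps the sample ratio in [-1, 1]. The
error of the ratio is then linear in the errors of the numerator and of the two variances
(`abs_corrSq_sub_le`), and a union bound over three events finishes. If a population variance
vanishes, then σ = 0 and the bound is trivial.

For laws without atoms, the integral definition reduces to the explicit form
(`pcovSq_eq_pcovSqExplicit`). The squared covariance of indicators is an expectation over five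
copies. By Fubini the directions are integrated first, and the directions in the intersection of two
half-spaces have measure π minus the angle (`sphereMeasure_wedge`). Replacing every angle by π minus
itself does not change the mean of the kernel (`integral_pcovKernel_reflect`). -/

namespace ProjCorr

/-! ### McDiarmid's inequality on a product space -/

section Product

variable {Z : Type*} [MeasurableSpace Z] (μ : Measure Z) [IsProbabilityMeasure μ]

/-- Integration over `n + 1` independent coordinates, one coordinate first. -/
theorem integral_pi_succ {n : ℕ} {f : (Fin (n + 1) → Z) → ℝ} (hf : Measurable f) {C : ℝ}
    (hC : ∀ z, |f z| ≤ C) :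
    ∫ z, f z ∂(Measure.pi fun _ : Fin (n + 1) => μ) =
      ∫ a, ∫ z, f (Fin.cons a z) ∂(Measure.pi fun _ : Fin n => μ) ∂μ := by
  have h := (measurePreserving_piFinSuccAbove (fun _ : Fin (n + 1) => μ) 0).symm
  rw [← h.integral_comp', integral_prod]
  · simp [Fin.insertNthEquiv]
  · refine Integrable.of_bound (C := C) ?_ ?_
    · exact (hf.comp (MeasurableEquiv.measurable _)).aestronglyMeasurable
    · exact Filter.Eventually.of_forall fun z => hC _

theorem measurable_finCons {n : ℕ} :
    Measurable fun w : Z × (Fin n → Z) => (Fin.cons w.1 w.2 : Fin (n + 1) → Z) := by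
  refine measurable_pi_lambda _ fun i => ?_
  refine Fin.cases ?_ (fun j => ?_) i
  · simpa using measurable_fst
  · simp only [Fin.cons_succ]
    fun_prop

/-- The exponential moment bound behind McDiarmid's inequality. -/
theorem integral_exp_boundedDifferences {n : ℕ} {f : (Fin n → Z) → ℝ} (hf : Measurable f)
    {C : ℝ} (hC : ∀ z, |f z| ≤ C) {c : ℝ}
    (hc : ∀ z j w, |f (Function.update z j w) - f z| ≤ c) (t : ℝ) :
    ∫ z, Real.exp (t * (f z - ∫ z', f z' ∂(Measure.pi fun _ : Fin n => μ)))
      ∂(Measure.pi fun _ : Fin n => μ) ≤ Real.exp (n * (c ^ 2 * t ^ 2 / 2)) := by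
  induction n with
  | zero =>
    have hz : ∀ z, f z = f Fin.elim0 := fun z => by congr 1; exact Subsingleton.elim _ _
    have : ∀ z, f z - ∫ z', f z' ∂(Measure.pi fun _ : Fin 0 => μ) = 0 := by
      intro z
      rw [integral_congr_ae (Filter.Eventually.of_forall hz), hz z]
      simp
    simp [this]
  | succ n ih =>
    set ν := Measure.pi fun _ : Fin n => μ with hν
    set m := ∫ z', f z' ∂(Measure.pi fun _ : Fin (n + 1) => μ) with hm
    -- One step of the Doob martingale: f - m = (f - g) + (g - m), where g is the conditional mean
    -- given the first coordinate. The induction hypothesis treats the first difference, Hoeffding's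
    -- lemma the second.
    set g : Z → ℝ := fun a => ∫ z, f (Fin.cons a z) ∂ν with hg
    have hfc : Measurable fun w : Z × (Fin n → Z) => f (Fin.cons w.1 w.2) :=
      hf.comp measurable_finCons
    have hfa : ∀ a, Measurable fun z : Fin n → Z => f (Fin.cons a z) := fun a =>
      hfc.comp (measurable_const.prodMk measurable_id)
    have hgm : Measurable g :=
      (hfc.stronglyMeasurable.integral_prod_right (ν := ν)).measurable
    have hint : ∀ a, Integrable (fun z => f (Fin.cons a z)) ν := fun a =>
      Integrable.of_bound (C := C) (hfa a).aestronglyMeasurable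
        (Filter.Eventually.of_forall fun z => hC _)
    have hgC : ∀ a, |g a| ≤ C := fun a => by
      have := norm_integral_le_of_norm_le_const (μ := ν) (f := fun z => f (Fin.cons a z)) (C := C)
        (Filter.Eventually.of_forall fun z => hC _)
      simpa using this
    have hgm' : m = ∫ a, g a ∂μ := integral_pi_succ μ hf hC
    have hmC : |m| ≤ C := by
      have := norm_integral_le_of_norm_le_const (μ := Measure.pi fun _ : Fin (n + 1) => μ)
        (f := f) (C := C) (Filter.Eventually.of_forall fun z => hC _)
      simpa using this
    have hgd : ∀ a b, |g a - g b| ≤ c := fun a b => by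
      have := norm_integral_le_of_norm_le_const (μ := ν)
        (f := fun z => f (Fin.cons a z) - f (Fin.cons b z)) (C := c)
        (Filter.Eventually.of_forall fun z => by
          have h := hc (Fin.cons b z) 0 a
          rwa [Fin.update_cons_zero] at h)
      rw [integral_sub (hint a) (hint b)] at this
      simpa using this
    have hgi : Integrable g μ := Integrable.of_bound (C := C) hgm.aestronglyMeasurable
        (Filter.Eventually.of_forall fun z => hgC _)
    have hcent : ∀ a, g a - m ∈ Set.Icc (-c) c := fun a => by
      have := norm_integral_le_of_norm_le_const (μ := μ)
        (f := fun b => g a - g b) (C := c) (Filter.Eventually.of_forall fun b => hgd a b)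
      rw [integral_sub (integrable_const _) hgi, ← hgm'] at this
      have : |g a - m| ≤ c := by simpa using this
      exact ⟨by linarith [neg_abs_le (g a - m)], by linarith [le_abs_self (g a - m)]⟩
    -- The interval [-c, c] has length 2c although g oscillates by at most c; this costs a factor
    -- four in the variance proxy and nothing else.
    have hhoef : ∫ a, Real.exp (t * (g a - m)) ∂μ ≤ Real.exp (c ^ 2 * t ^ 2 / 2) := by
      have h := (hasSubgaussianMGF_of_mem_Icc_of_integral_eq_zero (μ := μ)
        (X := fun a => g a - m) (hgm.sub_const m).aemeasurable
        (Filter.Eventually.of_forall hcent)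
        (by rw [integral_sub hgi (integrable_const _), ← hgm']; simp)).mgf_le t
      refine h.trans (Real.exp_le_exp.2 (le_of_eq ?_))
      have : ((‖c - -c‖₊ / 2 : NNReal) ^ 2 : NNReal) = ((c ^ 2 : ℝ)) := by
        push_cast
        rw [Real.norm_eq_abs, div_pow, sq_abs]
        ring
      rw [this]
    have hbd : ∀ z, |Real.exp (t * (f z - m))| ≤ Real.exp (|t| * (2 * C)) := fun z => by
      rw [abs_of_pos (Real.exp_pos _)]
      refine Real.exp_le_exp.2 ((le_abs_self _).trans ?_)
      rw [abs_mul]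
      gcongr
      exact (abs_sub _ _).trans (by linarith [hC z, hmC])
    rw [integral_pi_succ μ (by fun_prop) hbd]
    have hinner : ∀ a, ∫ z, Real.exp (t * (f (Fin.cons a z) - m)) ∂ν ≤
        Real.exp (n * (c ^ 2 * t ^ 2 / 2)) * Real.exp (t * (g a - m)) := fun a => by
      have h := ih (f := fun z => f (Fin.cons a z)) (hfa a) (fun z => hC _) (fun z j w => by
        rw [Fin.cons_update]; exact hc _ _ _)
      calc _ = ∫ z, Real.exp (t * (f (Fin.cons a z) - g a)) * Real.exp (t * (g a - m)) ∂ν := by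
            congr 1; ext z; rw [← Real.exp_add]; congr 1; ring
        _ = (∫ z, Real.exp (t * (f (Fin.cons a z) - g a)) ∂ν) * Real.exp (t * (g a - m)) :=
            integral_mul_const _ _
        _ ≤ _ := by gcongr
    have hgexp : Integrable (fun a => Real.exp (t * (g a - m))) μ := by
      refine Integrable.of_bound (C := Real.exp (|t| * (2 * C))) (by fun_prop)
        (Filter.Eventually.of_forall fun a => ?_)
      rw [Real.norm_eq_abs, abs_of_pos (Real.exp_pos _)]
      refine Real.exp_le_exp.2 ((le_abs_self _).trans ?_)
      rw [abs_mul]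
      gcongr
      exact (abs_sub _ _).trans (by linarith [hgC a, hmC])
    calc _ ≤ ∫ a, Real.exp (n * (c ^ 2 * t ^ 2 / 2)) * Real.exp (t * (g a - m)) ∂μ := by
          refine integral_mono_of_nonneg (Filter.Eventually.of_forall fun a => ?_)
            (hgexp.const_mul _) (Filter.Eventually.of_forall hinner)
          exact integral_nonneg fun z => (Real.exp_pos _).le
      _ = Real.exp (n * (c ^ 2 * t ^ 2 / 2)) * ∫ a, Real.exp (t * (g a - m)) ∂μ :=
          integral_const_mul _ _
      _ ≤ Real.exp (n * (c ^ 2 * t ^ 2 / 2)) * Real.exp (c ^ 2 * t ^ 2 / 2) := by gcongr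
      _ = _ := by rw [← Real.exp_add]; congr 1; push_cast; ring

/-- One-sided McDiarmid inequality. -/
theorem measureReal_ge_boundedDifferences {n : ℕ} {f : (Fin n → Z) → ℝ} (hf : Measurable f)
    {C : ℝ} (hC : ∀ z, |f z| ≤ C) {c : ℝ}
    (hc : ∀ z j w, |f (Function.update z j w) - f z| ≤ c) {δ : ℝ} (hδ : 0 ≤ δ) :
    (Measure.pi fun _ : Fin n => μ).real
      {z | δ ≤ f z - ∫ z', f z' ∂(Measure.pi fun _ : Fin n => μ)} ≤
      Real.exp (-δ ^ 2 / (2 * (n * c ^ 2))) := by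
  set ν := Measure.pi fun _ : Fin n => μ
  have h : HasSubgaussianMGF (fun z => f z - ∫ z', f z' ∂ν) ⟨n * c ^ 2, by positivity⟩ ν := by
    refine ⟨fun t => ?_, fun t => ?_⟩
    · refine integrable_exp_mul_of_mem_Icc (a := -C - ∫ z', f z' ∂ν) (b := C - ∫ z', f z' ∂ν)
        (by fun_prop) (Filter.Eventually.of_forall fun z => ?_)
      have := abs_le.1 (hC z)
      constructor <;> linarith
    · refine (integral_exp_boundedDifferences μ hf hC hc t).trans (Real.exp_le_exp.2 (le_of_eq ?_))
      change _ = (n * c ^ 2) * t ^ 2 / 2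
      ring
  exact h.measure_ge_le hδ

/-- McDiarmid's inequality. -/
theorem measureReal_abs_ge_boundedDifferences {n : ℕ} {f : (Fin n → Z) → ℝ} (hf : Measurable f)
    {C : ℝ} (hC : ∀ z, |f z| ≤ C) {c : ℝ}
    (hc : ∀ z j w, |f (Function.update z j w) - f z| ≤ c) {δ : ℝ} (hδ : 0 ≤ δ) :
    (Measure.pi fun _ : Fin n => μ).real
      {z | δ ≤ |f z - ∫ z', f z' ∂(Measure.pi fun _ : Fin n => μ)|} ≤
      2 * Real.exp (-δ ^ 2 / (2 * (n * c ^ 2))) := by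
  have h₁ := measureReal_ge_boundedDifferences μ hf hC hc hδ
  have h₂ := measureReal_ge_boundedDifferences μ (f := fun z => -f z) hf.neg (C := C)
    (fun z => by simpa using hC z) (c := c) (fun z j w => by
      have := hc z j w
      rwa [← abs_neg, show -(-f (Function.update z j w) - -f z) = f (Function.update z j w) - f z
        by ring]) hδ
  rw [two_mul]
  refine (measureReal_mono ?_).trans ((measureReal_union_le _ _).trans (add_le_add h₁ h₂))
  intro z hz
  rw [Set.mem_ofPred_eq, le_abs] at hz
  rw [integral_neg]
  rcases hz with hz | hz
  · exact Or.inl hz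
  · right
    rw [Set.mem_ofPred_eq]
    linarith

end Product

/-! ### Counting index tuples -/

section Combinatorics

/-- Deleting coordinate s is injective once its value is prescribed. -/
theorem card_filter_apply_eq {m n : ℕ} (s : Fin (m + 1)) (j : Fin n) :
    (Finset.univ.filter fun i : Fin (m + 1) → Fin n => i s = j).card ≤ n ^ m := by
  have h := Finset.card_le_card_of_injOn
    (s := Finset.univ.filter fun i : Fin (m + 1) → Fin n => i s = j)
    (t := (Finset.univ : Finset (Fin m → Fin n))) (fun i k => i (s.succAbove k))
    (fun _ _ => Finset.mem_coe.2 (Finset.mem_univ _)) (by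
      intro i hi i' hi' h
      simp only [Finset.coe_filter, Finset.mem_univ, true_and, Set.mem_ofPred_eq] at hi hi'
      have hk : ∀ k, i (s.succAbove k) = i' (s.succAbove k) := fun k => congrFun h k
      ext k
      rcases Fin.eq_self_or_eq_succAbove s k with rfl | ⟨k, rfl⟩
      · rw [hi, hi']
      · rw [hk k])
  simpa using h

/-- Deleting coordinate s is again injective: its value survives as coordinate t. -/
theorem card_filter_apply_eq_apply {m n : ℕ} {s t : Fin (m + 1)} (hst : s ≠ t) :
    (Finset.univ.filter fun i : Fin (m + 1) → Fin n => i s = i t).card ≤ n ^ m := by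
  have h := Finset.card_le_card_of_injOn
    (s := Finset.univ.filter fun i : Fin (m + 1) → Fin n => i s = i t)
    (t := (Finset.univ : Finset (Fin m → Fin n))) (fun i k => i (s.succAbove k))
    (fun _ _ => Finset.mem_coe.2 (Finset.mem_univ _)) (by
      intro i hi i' hi' h
      simp only [Finset.coe_filter, Finset.mem_univ, true_and, Set.mem_ofPred_eq] at hi hi'
      have hk : ∀ k, i (s.succAbove k) = i' (s.succAbove k) := fun k => congrFun h k
      ext k
      rcases Fin.eq_self_or_eq_succAbove s k with rfl | ⟨k, rfl⟩
      · obtain ⟨l, rfl⟩ := Fin.exists_succAbove_eq hst.symm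
        rw [hi, hi', hk]
      · rw [hk k])
  simpa using h

end Combinatorics

/-! ### Concentration of bounded `V`-statistics -/

section VStatistic

variable {Z : Type*} [MeasurableSpace Z] (μ : Measure Z) [IsProbabilityMeasure μ]

/-- Distinct members of an i.i.d. family are again i.i.d. This serves index tuples without
repetition as well as relabelling or selecting among the five copies. -/
theorem map_pi_comp_injective {ι κ : Type*} [Fintype ι] [Fintype κ] {e : ι → κ}
    (he : Function.Injective e) :
    (Measure.pi fun _ : κ => μ).map (fun z i => z (e i)) = Measure.pi fun _ : ι => μ := by
  have h : iIndepFun (fun (i : ι) (z : κ → Z) => z (e i)) (Measure.pi fun _ : κ => μ) :=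
    (iIndepFun_pi (μ := fun _ : κ => μ) (X := fun _ => id) (fun _ => aemeasurable_id)).precomp he
  rw [h.map_fun_eq_pi_map fun i => (measurable_pi_apply (e i)).aemeasurable]
  congr 1
  ext1 i
  exact (measurePreserving_eval (fun _ : κ => μ) (e i)).map_eq

/-- `ψ i` is the term with index tuple `i` of a `V`-statistic with kernel `φ`, the kernel being
possibly modified at tuples with repetitions. -/
structure IsVTerm {m n : ℕ} (φ : (Fin m → Z) → ℝ) (B : ℝ)
    (ψ : (Fin m → Fin n) → (Fin n → Z) → ℝ) : Prop where
  measurable_kernel : Measurable φ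
  abs_kernel_le : ∀ z, |φ z| ≤ B
  measurable : ∀ i, Measurable (ψ i)
  abs_le : ∀ i z, |ψ i z| ≤ B
  update_eq : ∀ i z j w, (∀ s, i s ≠ j) → ψ i (Function.update z j w) = ψ i z
  eq_kernel : ∀ i z, Function.Injective i → ψ i z = φ fun s => z (i s)

variable {m n : ℕ} {φ : (Fin (m + 1) → Z) → ℝ} {B : ℝ}
  {ψ : (Fin (m + 1) → Fin n) → (Fin n → Z) → ℝ}

namespace IsVTerm

theorem abs_average_le (h : IsVTerm φ B ψ) (hn : n ≠ 0) (z : Fin n → Z) :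
    |((n : ℝ) ^ (m + 1))⁻¹ * ∑ i, ψ i z| ≤ B := by
  have hn' : (0 : ℝ) < (n : ℝ) ^ (m + 1) := by positivity
  rw [abs_mul, abs_of_pos (inv_pos.2 hn'), inv_mul_le_iff₀ hn']
  refine (Finset.abs_sum_le_sum_abs _ _).trans ((Finset.sum_le_sum fun i _ => h.abs_le i z).trans ?_)
  simp

theorem measurable_average (h : IsVTerm φ B ψ) :
    Measurable fun z => ((n : ℝ) ^ (m + 1))⁻¹ * ∑ i, ψ i z :=
  (Finset.measurable_fun_sum _ fun i _ => h.measurable i).const_mul _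

/-- Only tuples containing j are affected: at most (m + 1)nᵐ out of nᵐ⁺¹, each changing by at most
2B. -/
theorem abs_average_update_sub_le (h : IsVTerm φ B ψ) (hB : 0 ≤ B) (z : Fin n → Z)
    (j : Fin n) (w : Z) :
    |((n : ℝ) ^ (m + 1))⁻¹ * ∑ i, ψ i (Function.update z j w) -
      ((n : ℝ) ^ (m + 1))⁻¹ * ∑ i, ψ i z| ≤ 2 * (m + 1) * B / n := by
  have hn : (0 : ℝ) < n := by exact_mod_cast j.pos
  rw [← mul_sub, ← Finset.sum_sub_distrib, abs_mul, abs_of_pos (by positivity),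
    inv_mul_le_iff₀ (by positivity)]
  have hterm : ∀ i : Fin (m + 1) → Fin n, |ψ i (Function.update z j w) - ψ i z| ≤
      ∑ s, if i s = j then 2 * B else 0 := fun i => by
    by_cases hi : ∃ s, i s = j
    · obtain ⟨s, hs⟩ := hi
      refine le_trans ?_ (Finset.single_le_sum (f := fun s => if i s = j then 2 * B else 0)
        (fun s _ => by positivity) (Finset.mem_univ s))
      simp only [hs, if_true]
      exact (abs_sub _ _).trans (by linarith [h.abs_le i z, h.abs_le i (Function.update z j w)])
    · push Not at hi
      rw [h.update_eq i z j w hi, sub_self, abs_zero]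
      exact Finset.sum_nonneg fun s _ => by positivity
  calc _ ≤ ∑ i : Fin (m + 1) → Fin n, ∑ s, if i s = j then 2 * B else 0 :=
        (Finset.abs_sum_le_sum_abs _ _).trans (Finset.sum_le_sum fun i _ => hterm i)
    _ = ∑ s : Fin (m + 1),
          ((Finset.univ.filter fun i : Fin (m + 1) → Fin n => i s = j).card : ℝ) * (2 * B) := by
        rw [Finset.sum_comm]
        simp [← Finset.sum_filter]
    _ ≤ ∑ s : Fin (m + 1), (n : ℝ) ^ m * (2 * B) := by
        gcongr with s
        exact_mod_cast card_filter_apply_eq s j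
    _ = _ := by
        simp only [Finset.sum_const, Finset.card_univ, Fintype.card_fin, nsmul_eq_mul]
        field_simp
        push_cast
        ring

theorem integral_term_of_injective (h : IsVTerm φ B ψ) {i : Fin (m + 1) → Fin n}
    (hi : Function.Injective i) :
    ∫ z, ψ i z ∂(Measure.pi fun _ : Fin n => μ) =
      ∫ z, φ z ∂(Measure.pi fun _ : Fin (m + 1) => μ) := by
  rw [← map_pi_comp_injective μ hi, integral_map
    (measurable_pi_lambda _ fun s => measurable_pi_apply (i s)).aemeasurable
    h.measurable_kernel.aestronglyMeasurable]
  exact integral_congr_ae (Filter.Eventually.of_forall fun z => h.eq_kernel i z hi)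

theorem abs_integral_term_sub_le (h : IsVTerm φ B ψ) (i : Fin (m + 1) → Fin n) :
    |∫ z, ψ i z ∂(Measure.pi fun _ : Fin n => μ) -
      ∫ z, φ z ∂(Measure.pi fun _ : Fin (m + 1) => μ)| ≤ 2 * B := by
  have h₁ := norm_integral_le_of_norm_le_const (μ := Measure.pi fun _ : Fin n => μ)
    (f := ψ i) (C := B) (Filter.Eventually.of_forall fun z => h.abs_le i z)
  have h₂ := norm_integral_le_of_norm_le_const (μ := Measure.pi fun _ : Fin (m + 1) => μ)
    (f := φ) (C := B) (Filter.Eventually.of_forall fun z => h.abs_kernel_le z)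
  simp only [Real.norm_eq_abs, probReal_univ, mul_one] at h₁ h₂
  exact (abs_sub _ _).trans (by linarith)

/-- Injective tuples contribute no bias. The others contribute at most 2B each, and a union bound
over ordered pairs of coinciding positions counts at most (m + 1)m nᵐ of them. This also absorbs any
convention for repeated indices. -/
theorem abs_integral_average_sub_le (h : IsVTerm φ B ψ) (hB : 0 ≤ B) (hn : n ≠ 0) :
    |∫ z, ((n : ℝ) ^ (m + 1))⁻¹ * ∑ i, ψ i z ∂(Measure.pi fun _ : Fin n => μ) -
      ∫ z, φ z ∂(Measure.pi fun _ : Fin (m + 1) => μ)| ≤ 2 * (m + 1) * m * B / n := by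
  set T := ∫ z, φ z ∂(Measure.pi fun _ : Fin (m + 1) => μ) with hT
  have hn' : (0 : ℝ) < n := by positivity
  have hterm : ∀ i : Fin (m + 1) → Fin n,
      |∫ z, ψ i z ∂(Measure.pi fun _ : Fin n => μ) - T| ≤
      ∑ s, ∑ t ∈ Finset.univ.erase s, if i s = i t then 2 * B else 0 := fun i => by
    have h0 : ∀ s, 0 ≤ ∑ t ∈ Finset.univ.erase s, if i s = i t then 2 * B else 0 :=
      fun s => Finset.sum_nonneg fun t _ => by positivity
    by_cases hi : Function.Injective i
    · rw [h.integral_term_of_injective μ hi, sub_self, abs_zero]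
      exact Finset.sum_nonneg fun s _ => h0 s
    · simp only [Function.Injective] at hi
      push Not at hi
      obtain ⟨s, t, hst, hne⟩ := hi
      refine (h.abs_integral_term_sub_le μ i).trans ?_
      refine le_trans ?_ (Finset.single_le_sum (fun s _ => h0 s) (Finset.mem_univ s))
      refine le_trans ?_ (Finset.single_le_sum (f := fun t => if i s = i t then 2 * B else 0)
        (fun t _ => by positivity) (Finset.mem_erase.2 ⟨hne.symm, Finset.mem_univ t⟩))
      simp [hst]
  have hint : ∀ i, Integrable (ψ i) (Measure.pi fun _ : Fin n => μ) := fun i =>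
    Integrable.of_bound (C := B) (h.measurable i).aestronglyMeasurable
      (Filter.Eventually.of_forall fun z => h.abs_le i z)
  have hsum : ∫ z, ((n : ℝ) ^ (m + 1))⁻¹ * ∑ i, ψ i z ∂(Measure.pi fun _ : Fin n => μ) - T =
      ((n : ℝ) ^ (m + 1))⁻¹ * ∑ i, (∫ z, ψ i z ∂(Measure.pi fun _ : Fin n => μ) - T) := by
    rw [integral_const_mul, integral_finsetSum _ fun i _ => hint i, Finset.sum_sub_distrib]
    simp only [Finset.sum_const, Finset.card_univ, Fintype.card_fun, Fintype.card_fin,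
      nsmul_eq_mul]
    push_cast
    field_simp
  rw [hsum, abs_mul, abs_of_pos (by positivity), inv_mul_le_iff₀ (by positivity)]
  calc _ ≤ ∑ i : Fin (m + 1) → Fin n,
        ∑ s, ∑ t ∈ Finset.univ.erase s, if i s = i t then 2 * B else 0 :=
        (Finset.abs_sum_le_sum_abs _ _).trans (Finset.sum_le_sum fun i _ => hterm i)
    _ = ∑ s : Fin (m + 1), ∑ t ∈ Finset.univ.erase s,
          ((Finset.univ.filter fun i : Fin (m + 1) → Fin n => i s = i t).card : ℝ) * (2 * B) := by
        rw [Finset.sum_comm]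
        refine Finset.sum_congr rfl fun s _ => ?_
        rw [Finset.sum_comm]
        simp [← Finset.sum_filter]
    _ ≤ ∑ s : Fin (m + 1), ∑ t ∈ Finset.univ.erase s, (n : ℝ) ^ m * (2 * B) := by
        gcongr with s _ t ht
        exact_mod_cast card_filter_apply_eq_apply (Finset.ne_of_mem_erase ht).symm
    _ = _ := by
        simp only [Finset.sum_const, Finset.card_univ, Fintype.card_fin, nsmul_eq_mul,
          Finset.card_erase_of_mem (Finset.mem_univ _), Nat.add_sub_cancel]
        field_simp
        push_cast
        ring

/-- A `V`-statistic of order five concentrates around the mean of its kernel, at any deviation. -/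
theorem measureReal_abs_sub_gt_le {φ : (Fin 5 → Z) → ℝ} {ψ : (Fin 5 → Fin n) → (Fin n → Z) → ℝ}
    (h : IsVTerm φ B ψ) (hB : 0 < B) (hn : n ≠ 0) {ε : ℝ} (hε : 0 < ε) :
    (Measure.pi fun _ : Fin n => μ).real {z | ε < |((n : ℝ) ^ 5)⁻¹ * ∑ i, ψ i z -
        ∫ z, φ z ∂(Measure.pi fun _ : Fin 5 => μ)|} ≤
      2 * Real.exp (-((800 * B ^ 2)⁻¹ * n * ε ^ 2)) := by
  set V : (Fin n → Z) → ℝ := fun z => ((n : ℝ) ^ 5)⁻¹ * ∑ i, ψ i z with hV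
  set T := ∫ z, φ z ∂(Measure.pi fun _ : Fin 5 => μ) with hT
  have hn' : (0 : ℝ) < n := by positivity
  have hVB : ∀ z, |V z| ≤ B := fun z => h.abs_average_le hn z
  have hTB : |T| ≤ B := by
    have := norm_integral_le_of_norm_le_const (μ := Measure.pi fun _ : Fin 5 => μ)
      (f := φ) (C := B) (Filter.Eventually.of_forall fun z => h.abs_kernel_le z)
    simpa using this
  have hbias : |∫ z, V z ∂(Measure.pi fun _ : Fin n => μ) - T| ≤ 40 * B / n := by
    have := h.abs_integral_average_sub_le μ hB.le hn
    refine this.trans (le_of_eq ?_)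
    norm_num
  have hdiff : ∀ z j w, |V (Function.update z j w) - V z| ≤ 10 * B / n := fun z j w => by
    refine (h.abs_average_update_sub_le hB.le z j w).trans (le_of_eq ?_)
    norm_num
  -- The threshold makes the bias 40B/n at most ε/2. McDiarmid at deviation ε/2 with differences
  -- 10B/n then gives the exponent (ε/2)² / (2n(10B/n)²) = nε²/(800B²).
  rcases le_or_gt (80 * B) (n * ε) with hlarge | hsmall
  · have hmc := measureReal_abs_ge_boundedDifferences μ h.measurable_average hVB hdiff
      (half_pos hε).le
    have hb : 40 * B / n ≤ ε / 2 := by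
      rw [div_le_iff₀ hn']
      linarith
    refine (measureReal_mono fun z hz => ?_).trans (hmc.trans (le_of_eq ?_))
    · change ε < |V z - T| at hz
      change ε / 2 ≤ |V z - _|
      have := abs_sub_le (V z) (∫ z, V z ∂(Measure.pi fun _ : Fin n => μ)) T
      linarith
    · congr 2
      field_simp
      norm_num
  -- Below the threshold no estimate is needed. Either ε ≥ 2B and the event is empty, or nε² <
  -- 160B², so the exponent is at most 1/5 and 2 exp(-1/5) ≥ 8/5 > 1.
  · rcases le_or_gt (2 * B) ε with hbig | hlt
    · have : {z | ε < |V z - T|} = ∅ := by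
        refine Set.eq_empty_of_forall_notMem fun z hz => ?_
        change ε < |V z - T| at hz
        have := abs_sub (V z) T
        linarith [hVB z]
      rw [this, measureReal_empty]
      positivity
    · refine measureReal_le_one.trans ?_
      have h1 : (800 * B ^ 2)⁻¹ * n * ε ^ 2 ≤ 1 / 5 := by
        rw [mul_assoc, inv_mul_le_iff₀ (by positivity)]
        nlinarith
      have h2 := Real.add_one_le_exp (-((800 * B ^ 2)⁻¹ * n * ε ^ 2))
      linarith

end IsVTerm

end VStatistic

/-! ### Bounds, symmetry and measurability of angles -/

section Angle

variable {p : ℕ}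

theorem arccosAngle_nonneg (u v w : E p) : 0 ≤ arccosAngle u v w := Real.arccos_nonneg _

theorem arccosAngle_le_pi (u v w : E p) : arccosAngle u v w ≤ Real.pi := Real.arccos_le_pi _

theorem abs_arccosAngle_le (u v w : E p) : |arccosAngle u v w| ≤ Real.pi := by
  rw [abs_of_nonneg (arccosAngle_nonneg u v w)]
  exact arccosAngle_le_pi u v w

theorem arccosAngle_comm (u v w : E p) : arccosAngle u v w = arccosAngle v u w := by
  rw [arccosAngle, arccosAngle, real_inner_comm, mul_comm]

theorem measurable_arccosAngle {α : Type*} [MeasurableSpace α] {f g h : α → E p}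
    (hf : Measurable f) (hg : Measurable g) (hh : Measurable h) :
    Measurable fun a => arccosAngle (f a) (g a) (h a) := by
  unfold arccosAngle
  exact Real.continuous_arccos.measurable.comp
    (((hf.sub hh).inner (hg.sub hh)).div ((hf.sub hh).norm.mul (hg.sub hh).norm))

variable {n : ℕ}

theorem sampleAngle_comm (X : Fin n → E p) (k l r : Fin n) :
    sampleAngle X k l r = sampleAngle X l k r := by
  simp only [sampleAngle, arccosAngle_comm (X k), or_comm]

theorem abs_sampleAngle_le (X : Fin n → E p) (k l r : Fin n) :
    |sampleAngle X k l r| ≤ Real.pi := by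
  rw [sampleAngle]
  split_ifs
  · simpa using Real.pi_pos.le
  · exact abs_arccosAngle_le _ _ _

theorem measurable_sampleAngle {α : Type*} [MeasurableSpace α] {X : α → Fin n → E p}
    (hX : ∀ i, Measurable fun a => X a i) (k l r : Fin n) :
    Measurable fun a => sampleAngle (X a) k l r := by
  unfold sampleAngle
  split_ifs
  · exact measurable_const
  · exact measurable_arccosAngle (hX k) (hX l) (hX r)

theorem sampleAngle_congr {X X' : Fin n → E p} {k l r : Fin n} (hk : X k = X' k) (hl : X l = X' l)
    (hr : X r = X' r) : sampleAngle X k l r = sampleAngle X' k l r := by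
  rw [sampleAngle, sampleAngle, hk, hl, hr]

end Angle

/-! ### Expanding the double centering -/

section Algebra

/-- Sum of products of two doubly centered symmetric matrices. -/
theorem sum_doublyCentered_mul {n : ℕ} (hn : n ≠ 0) {a b : Fin n → Fin n → ℝ}
    (ha : ∀ k l, a k l = a l k) (hb : ∀ k l, b k l = b l k) :
    ∑ k, ∑ l, (a k l - (n : ℝ)⁻¹ * ∑ l', a k l' - (n : ℝ)⁻¹ * ∑ k', a k' l
        + ((n : ℝ) ^ 2)⁻¹ * ∑ k', ∑ l', a k' l') *
      (b k l - (n : ℝ)⁻¹ * ∑ l', b k l' - (n : ℝ)⁻¹ * ∑ k', b k' l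
        + ((n : ℝ) ^ 2)⁻¹ * ∑ k', ∑ l', b k' l') =
    ∑ k, ∑ l, a k l * b k l + ((n : ℝ) ^ 2)⁻¹ * ((∑ k, ∑ l, a k l) * ∑ k, ∑ l, b k l)
      - 2 * ((n : ℝ)⁻¹ * ∑ l, (∑ k, a k l) * ∑ k, b k l) := by
  have hn' : (n : ℝ) ≠ 0 := by exact_mod_cast hn
  have hCa : ∀ l, ∑ k', a k' l = ∑ l', a l l' := fun l => Finset.sum_congr rfl fun k _ => ha k l
  have hCb : ∀ l, ∑ k', b k' l = ∑ l', b l l' := fun l => Finset.sum_congr rfl fun k _ => hb k l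
  simp only [hCa, hCb]
  set R : Fin n → ℝ := fun k => ∑ l, a k l with hR
  set R' : Fin n → ℝ := fun k => ∑ l, b k l with hR'
  set s := ∑ k, R k with hs
  set s' := ∑ k, R' k with hs'
  change ∑ k, ∑ l, (a k l - (n : ℝ)⁻¹ * R k - (n : ℝ)⁻¹ * R l + ((n : ℝ) ^ 2)⁻¹ * s) *
      (b k l - (n : ℝ)⁻¹ * R' k - (n : ℝ)⁻¹ * R' l + ((n : ℝ) ^ 2)⁻¹ * s') =
    ∑ k, ∑ l, a k l * b k l + ((n : ℝ) ^ 2)⁻¹ * (s * s') - 2 * ((n : ℝ)⁻¹ * ∑ l, R l * R' l)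
  set B : Fin n → Fin n → ℝ := fun k l =>
    b k l - (n : ℝ)⁻¹ * R' k - (n : ℝ)⁻¹ * R' l + ((n : ℝ) ^ 2)⁻¹ * s' with hB
  have hBrow : ∀ k, ∑ l, B k l = 0 := fun k => by
    simp only [hB, Finset.sum_add_distrib, Finset.sum_sub_distrib, ← Finset.mul_sum,
      Finset.sum_const, Finset.card_univ, Fintype.card_fin, nsmul_eq_mul]
    rw [← hs']
    change R' k - _ - _ + _ = 0
    field_simp
    ring
  have hBsymm : ∀ k l, B k l = B l k := fun k l => by simp only [hB, hb k l]; ring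
  have hBcol : ∀ l, ∑ k, B k l = 0 := fun l => by
    rw [← hBrow l]
    exact Finset.sum_congr rfl fun k _ => hBsymm k l
  -- Double centering is an orthogonal projection: `B` has vanishing row and column sums, so the
  -- centering of `a` drops out of the pairing.
  have h1 : ∑ k, ∑ l, (a k l - (n : ℝ)⁻¹ * R k - (n : ℝ)⁻¹ * R l + ((n : ℝ) ^ 2)⁻¹ * s) * B k l =
      ∑ k, ∑ l, a k l * B k l := by
    have e1 : ∑ k, ∑ l, R k * B k l = 0 := by simp [← Finset.mul_sum, hBrow]
    have e2 : ∑ k, ∑ l, R l * B k l = 0 := by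
      rw [Finset.sum_comm]
      simp [← Finset.mul_sum, hBcol]
    have e3 : ∑ k, ∑ l, B k l = 0 := by simp [hBrow]
    simp only [add_mul, sub_mul, mul_assoc, Finset.sum_add_distrib, Finset.sum_sub_distrib,
      ← Finset.mul_sum]
    rw [e2, e3]
    simp [hBrow]
  rw [h1]
  have e1 : ∑ k, ∑ l, a k l * R' k = ∑ l, R l * R' l := by simp [← Finset.sum_mul, hR]
  have e2 : ∑ k, ∑ l, a k l * R' l = ∑ l, R l * R' l := by
    rw [Finset.sum_comm]
    simp only [← Finset.sum_mul, hCa, hR]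
  have e3 : ∑ k, ∑ l, a k l * s' = s * s' := by simp [← Finset.sum_mul, hs, hR]
  have h2 : ∀ k l, a k l * B k l = a k l * b k l - (n : ℝ)⁻¹ * (a k l * R' k)
      - (n : ℝ)⁻¹ * (a k l * R' l) + ((n : ℝ) ^ 2)⁻¹ * (a k l * s') := fun k l => by
    simp only [hB]; ring
  simp only [h2, Finset.sum_add_distrib, Finset.sum_sub_distrib, ← Finset.mul_sum] at e1 e2 e3 ⊢
  rw [e1, e2, e3]
  ring

theorem sum_fin_succ_fun {ι : Type*} [Fintype ι] {m : ℕ} (f : (Fin (m + 1) → ι) → ℝ) :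
    ∑ i, f i = ∑ a, ∑ i : Fin m → ι, f (Fin.cons a i) := by
  rw [← (Fin.consEquiv fun _ : Fin (m + 1) => ι).sum_comp, Fintype.sum_prod_type]
  rfl

theorem sum_fin_five_fun {ι : Type*} [Fintype ι] (f : ι → ι → ι → ι → ι → ℝ) :
    ∑ i : Fin 5 → ι, f (i 0) (i 1) (i 2) (i 3) (i 4) =
      ∑ a, ∑ b, ∑ c, ∑ d, ∑ e, f a b c d e := by
  simp only [sum_fin_succ_fun, Fintype.sum_unique]
  rfl

/-- Slot 2 is the vertex r, and slots 0 and 3 are the endpoints of the a-angle. The three terms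
involve three, five and four of the indices; summing over the idle ones yields n², 1 and n, which
brings all terms to the common factor n⁻⁵. -/
theorem centered_sum_eq {n : ℕ} (hn : n ≠ 0) {a b : Fin n → Fin n → Fin n → ℝ}
    (ha : ∀ k l r, a k l r = a l k r) (hb : ∀ k l r, b k l r = b l k r) :
    ((n : ℝ) ^ 3)⁻¹ * ∑ k, ∑ l, ∑ r,
      (a k l r - (n : ℝ)⁻¹ * ∑ l', a k l' r - (n : ℝ)⁻¹ * ∑ k', a k' l r
        + ((n : ℝ) ^ 2)⁻¹ * ∑ k', ∑ l', a k' l' r) *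
      (b k l r - (n : ℝ)⁻¹ * ∑ l', b k l' r - (n : ℝ)⁻¹ * ∑ k', b k' l r
        + ((n : ℝ) ^ 2)⁻¹ * ∑ k', ∑ l', b k' l' r) =
    ((n : ℝ) ^ 5)⁻¹ * ∑ i : Fin 5 → Fin n,
      (a (i 0) (i 3) (i 2) * b (i 0) (i 3) (i 2) + a (i 0) (i 3) (i 2) * b (i 1) (i 4) (i 2)
        - 2 * (a (i 0) (i 3) (i 2) * b (i 1) (i 3) (i 2))) := by
  have hn' : (n : ℝ) ≠ 0 := by exact_mod_cast hn
  have hreorder : ∀ F : Fin n → Fin n → Fin n → ℝ,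
      ∑ k, ∑ l, ∑ r, F k l r = ∑ r, ∑ k, ∑ l, F k l r := fun F => by
    rw [Finset.sum_comm' (t' := Finset.univ) (s' := fun _ => Finset.univ) (by simp)]
    simp only [Finset.sum_comm (f := fun k r => F k _ r)]
    rw [Finset.sum_comm]
    refine Finset.sum_congr rfl fun r _ => Finset.sum_comm
  rw [hreorder]
  simp only [fun r => sum_doublyCentered_mul hn (fun k l => ha k l r) (fun k l => hb k l r)]
  rw [sum_fin_five_fun fun i j r k l => a i k r * b i k r + a i k r * b j l r
    - 2 * (a i k r * b j k r)]
  have hr : ∀ F : Fin n → Fin n → Fin n → ℝ, ∑ i, ∑ j, ∑ r, F i j r = ∑ r, ∑ i, ∑ j, F i j r :=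
    hreorder
  rw [hr, Finset.mul_sum, Finset.mul_sum]
  refine Finset.sum_congr rfl fun r _ => ?_
  simp only [Finset.sum_add_distrib, Finset.sum_sub_distrib, Finset.sum_const, Finset.card_univ,
    Fintype.card_fin, nsmul_eq_mul, ← Finset.mul_sum]
  have e2 : ∑ i, ∑ j, ∑ k, a i k r * b j k r = ∑ l, (∑ k, a k l r) * ∑ k, b k l r := by
    simp only [Finset.sum_mul_sum]
    exact hreorder fun i j k => a i k r * b j k r
  have e3 : ∑ x, ∑ y, ∑ z, a x z r * ∑ i, b y i r =
      (∑ k, ∑ l, a k l r) * ∑ k, ∑ l, b k l r := by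
    simp only [← Finset.sum_mul, ← Finset.mul_sum]
  rw [e2, e3]
  field_simp

end Algebra

/-! ### The sample covariance as a `V`-statistic -/

section Kernel

variable {p q n : ℕ}

/-- The kernel of the explicit form of the squared projection covariance. -/
noncomputable def pcovKernel (z : Fin 5 → E p × E q) : ℝ :=
  arccosAngle (z 0).1 (z 3).1 (z 2).1 * arccosAngle (z 0).2 (z 3).2 (z 2).2 +
    arccosAngle (z 0).1 (z 3).1 (z 2).1 * arccosAngle (z 1).2 (z 4).2 (z 2).2 -
    2 * (arccosAngle (z 0).1 (z 3).1 (z 2).1 * arccosAngle (z 1).2 (z 3).2 (z 2).2)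

/-- The terms of `samplePcovSq` as a `V`-statistic of order five. -/
noncomputable def samplePcovTerm (i : Fin 5 → Fin n) (z : Fin n → E p × E q) : ℝ :=
  sampleAngle (fun k => (z k).1) (i 0) (i 3) (i 2) *
      sampleAngle (fun k => (z k).2) (i 0) (i 3) (i 2) +
    sampleAngle (fun k => (z k).1) (i 0) (i 3) (i 2) *
      sampleAngle (fun k => (z k).2) (i 1) (i 4) (i 2) -
    2 * (sampleAngle (fun k => (z k).1) (i 0) (i 3) (i 2) *
      sampleAngle (fun k => (z k).2) (i 1) (i 3) (i 2))

theorem samplePcovSq_eq_sum (hn : n ≠ 0) (z : Fin n → E p × E q) :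
    samplePcovSq (fun k => (z k).1) (fun k => (z k).2) =
      ((n : ℝ) ^ 5)⁻¹ * ∑ i, samplePcovTerm i z :=
  centered_sum_eq hn (sampleAngle_comm fun k => (z k).1) (sampleAngle_comm fun k => (z k).2)

/-- Factoring out a leaves b₁ + b₂ - 2b₃, which is at most 4c. With c = π this is where M = 4π²
comes from; c = 1 serves the indicator kernels. -/
theorem abs_kernel_combination_le {a b₁ b₂ b₃ c : ℝ} (ha : |a| ≤ c) (h₁ : |b₁| ≤ c)
    (h₂ : |b₂| ≤ c) (h₃ : |b₃| ≤ c) : |a * b₁ + a * b₂ - 2 * (a * b₃)| ≤ 4 * c ^ 2 := by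
  have hc : 0 ≤ c := (abs_nonneg a).trans ha
  rw [show a * b₁ + a * b₂ - 2 * (a * b₃) = a * (b₁ + b₂ - 2 * b₃) by ring, abs_mul]
  have : |b₁ + b₂ - 2 * b₃| ≤ 4 * c := by
    rw [abs_le] at *
    constructor <;> linarith
  calc |a| * |b₁ + b₂ - 2 * b₃| ≤ c * (4 * c) := by gcongr
    _ = _ := by ring

theorem isVTerm_samplePcovTerm :
    IsVTerm (pcovKernel (p := p) (q := q)) M (samplePcovTerm (n := n)) where
  measurable_kernel := by
    have h1 : ∀ i j k : Fin 5, Measurable fun z : Fin 5 → E p × E q =>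
        arccosAngle (z i).1 (z j).1 (z k).1 := fun i j k =>
      measurable_arccosAngle (measurable_pi_apply i).fst (measurable_pi_apply j).fst
        (measurable_pi_apply k).fst
    have h2 : ∀ i j k : Fin 5, Measurable fun z : Fin 5 → E p × E q =>
        arccosAngle (z i).2 (z j).2 (z k).2 := fun i j k =>
      measurable_arccosAngle (measurable_pi_apply i).snd (measurable_pi_apply j).snd
        (measurable_pi_apply k).snd
    exact (((h1 _ _ _).mul (h2 _ _ _)).add ((h1 _ _ _).mul (h2 _ _ _))).sub
      (((h1 _ _ _).mul (h2 _ _ _)).const_mul 2)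
  abs_kernel_le z := abs_kernel_combination_le (abs_arccosAngle_le _ _ _)
    (abs_arccosAngle_le _ _ _) (abs_arccosAngle_le _ _ _) (abs_arccosAngle_le _ _ _)
  measurable i := by
    have h1 : ∀ i j k : Fin n, Measurable fun z : Fin n → E p × E q =>
        sampleAngle (fun k => (z k).1) i j k :=
      measurable_sampleAngle fun i => (measurable_pi_apply i).fst
    have h2 : ∀ i j k : Fin n, Measurable fun z : Fin n → E p × E q =>
        sampleAngle (fun k => (z k).2) i j k :=
      measurable_sampleAngle fun i => (measurable_pi_apply i).snd
    exact (((h1 _ _ _).mul (h2 _ _ _)).add ((h1 _ _ _).mul (h2 _ _ _))).sub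
      (((h1 _ _ _).mul (h2 _ _ _)).const_mul 2)
  abs_le i z := abs_kernel_combination_le (abs_sampleAngle_le _ _ _ _)
    (abs_sampleAngle_le _ _ _ _) (abs_sampleAngle_le _ _ _ _) (abs_sampleAngle_le _ _ _ _)
  update_eq i z j w h := by
    have hu : ∀ s, Function.update z j w (i s) = z (i s) := fun s =>
      Function.update_of_ne (h s) _ _
    have h1 : ∀ r s t, sampleAngle (fun k => (Function.update z j w k).1) (i r) (i s) (i t) =
        sampleAngle (fun k => (z k).1) (i r) (i s) (i t) := fun r s t =>
      sampleAngle_congr (by rw [hu]) (by rw [hu]) (by rw [hu])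
    have h2 : ∀ r s t, sampleAngle (fun k => (Function.update z j w k).2) (i r) (i s) (i t) =
        sampleAngle (fun k => (z k).2) (i r) (i s) (i t) := fun r s t =>
      sampleAngle_congr (by rw [hu]) (by rw [hu]) (by rw [hu])
    simp only [samplePcovTerm, h1, h2]
  -- Distinct indices switch off the cutoff in `sampleAngle`. Equal points at distinct indices get
  -- the same degenerate angle on both sides, so atoms do no harm.
  eq_kernel i z h := by
    simp [samplePcovTerm, pcovKernel, sampleAngle, h.eq_iff]

theorem M_pos : 0 < M := by
  unfold M
  positivity

theorem abs_samplePcovSq_le (hn : n ≠ 0) (X : Fin n → E p) (Y : Fin n → E q) :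
    |samplePcovSq X Y| ≤ M := by
  have h := (isVTerm_samplePcovTerm (n := n)).abs_average_le hn fun k => (X k, Y k)
  rwa [← samplePcovSq_eq_sum hn] at h

/-- Cauchy-Schwarz inequality for the sample projection covariance. -/
theorem abs_samplePcovSq_le_sqrt (X : Fin n → E p) (Y : Fin n → E q) :
    |samplePcovSq X Y| ≤ √(samplePcovSq X X) * √(samplePcovSq Y Y) := by
  have hc : (0 : ℝ) ≤ ((n : ℝ) ^ 3)⁻¹ := by positivity
  have h := Finset.sum_mul_sq_le_sq_mul_sq (Finset.univ : Finset (Fin n × Fin n × Fin n))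
    (fun t => sampleCentered X t.1 t.2.1 t.2.2) (fun t => sampleCentered Y t.1 t.2.1 t.2.2)
  simp only [Fintype.sum_prod_type, sq (sampleCentered _ _ _ _)] at h
  rw [← Real.sqrt_mul', ← Real.sqrt_sq_eq_abs]
  · refine Real.sqrt_le_sqrt ?_
    unfold samplePcovSq
    calc _ = (((n : ℝ) ^ 3)⁻¹) ^ 2 * (∑ k, ∑ l, ∑ r, sampleCentered X k l r *
          sampleCentered Y k l r) ^ 2 := by ring
      _ ≤ _ := mul_le_mul_of_nonneg_left h (by positivity)
      _ = _ := by ring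
  · unfold samplePcovSq
    exact mul_nonneg hc (Finset.sum_nonneg fun _ _ => Finset.sum_nonneg fun _ _ =>
      Finset.sum_nonneg fun _ _ => mul_self_nonneg _)

theorem samplePcovSq_self_nonneg (X : Fin n → E p) : 0 ≤ samplePcovSq X X := by
  unfold samplePcovSq
  exact mul_nonneg (by positivity) (Finset.sum_nonneg fun _ _ => Finset.sum_nonneg fun _ _ =>
    Finset.sum_nonneg fun _ _ => mul_self_nonneg _)

end Kernel

/-! ### The explicit population quantity -/

section Explicit

variable {p q : ℕ} {Ω : Type*} [MeasurableSpace Ω] (P : Measure Ω) [IsProbabilityMeasure P]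

theorem integral_pcovKernel_eq (μ : Measure (E p × E q)) [IsProbabilityMeasure μ] :
    ∫ z, pcovKernel z ∂(Measure.pi fun _ : Fin 5 => μ) =
      (∫ z : Fin 5 → E p × E q, arccosAngle (z 0).1 (z 3).1 (z 2).1 *
        arccosAngle (z 0).2 (z 3).2 (z 2).2 ∂(Measure.pi fun _ => μ)) +
      (∫ z : Fin 5 → E p × E q, arccosAngle (z 0).1 (z 3).1 (z 2).1 *
        arccosAngle (z 1).2 (z 4).2 (z 2).2 ∂(Measure.pi fun _ => μ)) -
      2 * (∫ z : Fin 5 → E p × E q, arccosAngle (z 0).1 (z 3).1 (z 2).1 *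
        arccosAngle (z 1).2 (z 3).2 (z 2).2 ∂(Measure.pi fun _ => μ)) := by
  have hi : ∀ i j k i' j' k' : Fin 5, Integrable (fun z : Fin 5 → E p × E q =>
      arccosAngle (z i).1 (z j).1 (z k).1 * arccosAngle (z i').2 (z j').2 (z k').2)
      (Measure.pi fun _ => μ) := fun i j k i' j' k' => by
    refine Integrable.of_bound (C := Real.pi * Real.pi) ?_ (Filter.Eventually.of_forall fun z => ?_)
    · exact ((measurable_arccosAngle (measurable_pi_apply i).fst (measurable_pi_apply j).fst
        (measurable_pi_apply k).fst).mul (measurable_arccosAngle (measurable_pi_apply i').snd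
        (measurable_pi_apply j').snd (measurable_pi_apply k').snd)).aestronglyMeasurable
    · rw [norm_mul]
      exact mul_le_mul (abs_arccosAngle_le _ _ _) (abs_arccosAngle_le _ _ _) (norm_nonneg _)
        Real.pi_pos.le
  refine (integral_sub ((hi 0 3 2 0 3 2).add (hi 0 3 2 1 4 2))
    ((hi 0 3 2 1 3 2).const_mul 2)).trans ?_
  rw [integral_const_mul]
  congr 1
  exact integral_add (hi 0 3 2 0 3 2) (hi 0 3 2 1 4 2)

/-- The explicit form is a functional of the joint law. -/
theorem pcovSqExplicit_eq_integral_pcovKernel {x : Ω → E p} {y : Ω → E q} (hx : AEMeasurable x P)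
    (hy : AEMeasurable y P) :
    pcovSqExplicit P x y =
      ∫ z, pcovKernel z ∂(Measure.pi fun _ : Fin 5 => P.map fun ω => (x ω, y ω)) := by
  have hxy : AEMeasurable (fun ω => (x ω, y ω)) P := hx.prodMk hy
  have : IsProbabilityMeasure (P.map fun ω => (x ω, y ω)) := Measure.isProbabilityMeasure_map hxy
  have hpi : (Measure.pi fun _ : Fin 5 => P.map fun ω => (x ω, y ω)) =
      (Measure.pi fun _ : Fin 5 => P).map (fun ω i => (x (ω i), y (ω i))) :=
    (Measure.pi_map_pi (μ := fun _ : Fin 5 => P) (f := fun _ ω => (x ω, y ω)) fun _ => hxy).symm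
  have hm : AEMeasurable (fun (ω : Fin 5 → Ω) i => (x (ω i), y (ω i)))
      (Measure.pi fun _ : Fin 5 => P) :=
    aemeasurable_pi_lambda _ fun i => hxy.comp_quasiMeasurePreserving
      (Measure.quasiMeasurePreserving_eval _ i)
  have hi : ∀ i j k i' j' k' : Fin 5, Measurable (fun z : Fin 5 → E p × E q =>
      arccosAngle (z i).1 (z j).1 (z k).1 * arccosAngle (z i').2 (z j').2 (z k').2) :=
    fun i j k i' j' k' =>
      (measurable_arccosAngle (measurable_pi_apply i).fst (measurable_pi_apply j).fst
        (measurable_pi_apply k).fst).mul (measurable_arccosAngle (measurable_pi_apply i').snd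
        (measurable_pi_apply j').snd (measurable_pi_apply k').snd)
  rw [integral_pcovKernel_eq, hpi, integral_map hm (hi _ _ _ _ _ _).aestronglyMeasurable,
    integral_map hm (hi _ _ _ _ _ _).aestronglyMeasurable,
    integral_map hm (hi _ _ _ _ _ _).aestronglyMeasurable]
  rfl

theorem abs_pcovSqExplicit_le {x : Ω → E p} {y : Ω → E q} (hx : AEMeasurable x P)
    (hy : AEMeasurable y P) : |pcovSqExplicit P x y| ≤ M := by
  rw [pcovSqExplicit_eq_integral_pcovKernel P hx hy]
  have hxy : AEMeasurable (fun ω => (x ω, y ω)) P := hx.prodMk hy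
  have : IsProbabilityMeasure (P.map fun ω => (x ω, y ω)) := Measure.isProbabilityMeasure_map hxy
  have h := norm_integral_le_of_norm_le_const
    (μ := Measure.pi fun _ : Fin 5 => P.map fun ω => (x ω, y ω)) (f := pcovKernel) (C := M)
    (Filter.Eventually.of_forall fun z => (isVTerm_samplePcovTerm (n := 0)).abs_kernel_le z)
  simpa using h

/-- The sign is not visible in S₁ + S₂ - 2S₃. The sample version is a sum of squares, and its mean
is within 40M/n of the population value; let n tend to infinity. -/
theorem pcovSqExplicit_self_nonneg {x : Ω → E p} (hx : AEMeasurable x P) :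
    0 ≤ pcovSqExplicit P x x := by
  have hxx : AEMeasurable (fun ω => (x ω, x ω)) P := hx.prodMk hx
  have : IsProbabilityMeasure (P.map fun ω => (x ω, x ω)) := Measure.isProbabilityMeasure_map hxx
  rw [pcovSqExplicit_eq_integral_pcovKernel P hx hx]
  set μ := P.map fun ω => (x ω, x ω) with hμ
  set T := ∫ z, pcovKernel z ∂(Measure.pi fun _ : Fin 5 => μ) with hT
  -- The law of (x, x) lives on the diagonal, so almost surely the two halves of the sample coincide
  -- and the sum of squares appears.
  have hdiag : ∀ᵐ z ∂μ, z.1 = z.2 := by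
    rw [hμ, ae_map_iff hxx (measurableSet_eq_fun measurable_fst measurable_snd)]
    exact Filter.Eventually.of_forall fun _ => rfl
  have hlow : ∀ n : ℕ, -(40 * M) / (n + 1 : ℕ) ≤ T := fun n => by
    have hb := (isVTerm_samplePcovTerm (n := n + 1) (p := p) (q := p)).abs_integral_average_sub_le
      μ M_pos.le n.succ_ne_zero
    have hnn : 0 ≤ ∫ z, (((n + 1 : ℕ) : ℝ) ^ 5)⁻¹ * ∑ i, samplePcovTerm i z
        ∂(Measure.pi fun _ : Fin (n + 1) => μ) := by
      refine integral_nonneg_of_ae ?_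
      have hae : ∀ᵐ z ∂(Measure.pi fun _ : Fin (n + 1) => μ), ∀ i, (z i).1 = (z i).2 := by
        rw [ae_all_iff]
        exact fun i => (Measure.quasiMeasurePreserving_eval (fun _ : Fin (n + 1) => μ) i).ae hdiag
      filter_upwards [hae] with z hz
      rw [← samplePcovSq_eq_sum n.succ_ne_zero]
      simp only [hz]
      exact samplePcovSq_self_nonneg _
    have := (abs_le.1 hb).2
    have e : (2 * ((4 : ℕ) + 1) * (4 : ℕ) * M / (n + 1 : ℕ) : ℝ) = -(-(40 * M) / (n + 1 : ℕ)) := by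
      push_cast
      ring
    rw [e] at this
    linarith
  have hlim : Filter.Tendsto (fun n : ℕ => -(40 * M) / ((n + 1 : ℕ) : ℝ)) Filter.atTop (nhds 0) :=
    (tendsto_const_div_atTop_nhds_zero_nat (-(40 * M))).comp (Filter.tendsto_add_atTop_nat 1)
  exact le_of_tendsto' hlim hlow

end Explicit

/-! ### Exponential inequalities for covariance and correlation -/

section Concentration

variable {p q n : ℕ} {Ω : Type*} [MeasurableSpace Ω] {P : Measure Ω} [IsProbabilityMeasure P]
  {Ω' : Type*} [MeasurableSpace Ω'] {P' : Measure Ω'} [IsProbabilityMeasure P']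

/-- Exponential inequality for the sample projection covariance, with the explicit form of the
population quantity. -/
theorem measureReal_samplePcovSq_sub_gt_le (hn : n ≠ 0) {x : Ω → E p} {y : Ω → E q}
    {X : Fin n → Ω' → E p} {Y : Fin n → Ω' → E q}
    (hindep : iIndepFun (fun i ω => (X i ω, Y i ω)) P')
    (hident : ∀ i, IdentDistrib (fun ω => (X i ω, Y i ω)) (fun ω => (x ω, y ω)) P' P)
    (hx : AEMeasurable x P) (hy : AEMeasurable y P) {ε : ℝ} (hε : 0 < ε) :
    P'.real {ω | ε < |samplePcovSq (fun i => X i ω) (fun i => Y i ω) - pcovSqExplicit P x y|} ≤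
      2 * Real.exp (-((800 * M ^ 2)⁻¹ * n * ε ^ 2)) := by
  have hxy : AEMeasurable (fun ω => (x ω, y ω)) P := hx.prodMk hy
  have : IsProbabilityMeasure (P.map fun ω => (x ω, y ω)) := Measure.isProbabilityMeasure_map hxy
  have hZ : AEMeasurable (fun ω i => (X i ω, Y i ω)) P' :=
    aemeasurable_pi_lambda _ fun i => (hident i).aemeasurable_fst
  have hlaw : P'.map (fun ω i => (X i ω, Y i ω)) =
      Measure.pi fun _ : Fin n => P.map fun ω => (x ω, y ω) := by
    rw [hindep.map_fun_eq_pi_map fun i => (hident i).aemeasurable_fst]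
    congr 1
    ext1 i
    exact (hident i).map_eq
  have h := isVTerm_samplePcovTerm.measureReal_abs_sub_gt_le (P.map fun ω => (x ω, y ω)) M_pos hn hε
  rw [← hlaw, ← pcovSqExplicit_eq_integral_pcovKernel P hx hy, map_measureReal_apply_of_aemeasurable
    hZ] at h
  · refine (measureReal_mono fun ω hω => ?_).trans h
    change ε < _ at hω
    change ε < |_ - _|
    rwa [← samplePcovSq_eq_sum hn]
  · exact measurableSet_lt measurable_const
      ((isVTerm_samplePcovTerm.measurable_average.sub_const _).abs)

/-- Perturbation bound for the squared correlation. -/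
theorem abs_corrSq_sub_le {N A B T a b m ε : ℝ} (hA : 0 ≤ A) (hAm : A ≤ m)
    (hB : 0 ≤ B) (ha : 0 < a) (hb : 0 < b) (hbm : b ≤ m) (hN : |N| ≤ √A * √B)
    (h₁ : |N - T| ≤ ε * (√a * √b) / 2) (h₂ : |A - a| ≤ ε * (a * b) / (4 * m))
    (h₃ : |B - b| ≤ ε * (a * b) / (4 * m)) : |corrSq N A B - corrSq T a b| ≤ ε := by
  have hm : 0 < m := hb.trans_le hbm
  unfold corrSq
  set D := √a * √b with hD
  set D' := √A * √B with hD'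
  have hDpos : 0 < D := mul_pos (Real.sqrt_pos.2 ha) (Real.sqrt_pos.2 hb)
  have hD'nn : 0 ≤ D' := by positivity
  have hDsq : D * D = a * b := by
    rw [hD, mul_mul_mul_comm, Real.mul_self_sqrt ha.le, Real.mul_self_sqrt hb.le]
  have hD'sq : D' * D' = A * B := by
    rw [hD', mul_mul_mul_comm, Real.mul_self_sqrt hA, Real.mul_self_sqrt hB]
  -- The square roots are compared through D'² - D² = AB - ab, divided by D' + D ≥ D; no lower bound
  -- on D' is needed.
  have hdiff : |D' - D| ≤ ε * D / 2 := by
    have h4 : |A * B - a * b| ≤ ε * (a * b) / 2 := by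
      rw [show A * B - a * b = A * (B - b) + b * (A - a) by ring]
      refine (abs_add_le _ _).trans ?_
      rw [abs_mul, abs_mul, abs_of_nonneg hA, abs_of_pos hb]
      calc A * |B - b| + b * |A - a| ≤ m * (ε * (a * b) / (4 * m)) + m * (ε * (a * b) / (4 * m)) := by
            gcongr
        _ = _ := by field_simp; ring
    have h5 : |D' - D| * (D' + D) = |A * B - a * b| := by
      rw [← hDsq, ← hD'sq, show D' * D' - D * D = (D' - D) * (D' + D) by ring, abs_mul,
        abs_of_nonneg (add_nonneg hD'nn hDpos.le)]
    have h6 : |D' - D| * D ≤ (ε * D / 2) * D := by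
      calc _ ≤ |D' - D| * (D' + D) := by gcongr; linarith
        _ ≤ _ := h5.le.trans (h4.trans (le_of_eq (by rw [← hDsq]; ring)))
    exact le_of_mul_le_mul_right h6 hDpos
  -- If D' = 0, Cauchy-Schwarz forces N = 0, so the convention for division by zero is harmless.
  have hND : N / D' * D' = N := by
    rcases eq_or_ne D' 0 with h0 | h0
    · rw [h0] at hN ⊢
      rw [mul_zero, eq_comm]
      exact abs_nonpos_iff.1 hN
    · exact div_mul_cancel₀ _ h0
  have hr : |N / D'| ≤ 1 := by
    rw [abs_div, abs_of_nonneg hD'nn]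
    exact div_le_one_of_le₀ hN hD'nn
  -- Clearing D rather than D' lets the sample ratio, bounded by 1, multiply the denominator error.
  -- Each of the two terms is then at most εD/2.
  have key : (N / D' - T / D) * D = N / D' * (D - D') + (N - T) := by
    rw [sub_mul, div_mul_cancel₀ _ hDpos.ne', mul_sub, hND]
    ring
  have : |N / D' - T / D| * D ≤ ε * D := by
    rw [← abs_of_pos hDpos, ← abs_mul, abs_of_pos hDpos, key]
    refine (abs_add_le _ _).trans ?_
    rw [abs_mul, abs_sub_comm D]
    have : |N / D'| * |D' - D| ≤ 1 * (ε * D / 2) := by gcongr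
    linarith
  exact le_of_mul_le_mul_right this hDpos

theorem two_le_M : 2 ≤ M := by
  unfold M
  nlinarith [Real.pi_gt_three]

/-- Exponential inequality for the sample projection correlation, with the explicit form of the
population quantities. -/
theorem measureReal_corrSq_sub_gt_le (hn : n ≠ 0) {x : Ω → E p} {y : Ω → E q}
    {X : Fin n → Ω' → E p} {Y : Fin n → Ω' → E q}
    (hindep : iIndepFun (fun i ω => (X i ω, Y i ω)) P')
    (hident : ∀ i, IdentDistrib (fun ω => (X i ω, Y i ω)) (fun ω => (x ω, y ω)) P' P)
    (hx : AEMeasurable x P) (hy : AEMeasurable y P) {ε : ℝ} (hε : 0 < ε) :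
    P'.real {ω | ε < |corrSq (samplePcovSq (fun i => X i ω) (fun i => Y i ω))
          (samplePcovSq (fun i => X i ω) (fun i => X i ω))
          (samplePcovSq (fun i => Y i ω) (fun i => Y i ω)) -
        corrSq (pcovSqExplicit P x y) (pcovSqExplicit P x x) (pcovSqExplicit P y y)|} ≤
      5 * 2 * Real.exp (-((800 * M ^ 2)⁻¹ *
        sigma (pcovSqExplicit P x x) (pcovSqExplicit P y y) * n * ε ^ 2)) := by
  set a := pcovSqExplicit P x x with ha
  set b := pcovSqExplicit P y y with hb
  have ha0 : 0 ≤ a := pcovSqExplicit_self_nonneg P hx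
  have hb0 : 0 ≤ b := pcovSqExplicit_self_nonneg P hy
  have haM : a ≤ M := (le_abs_self _).trans (abs_pcovSqExplicit_le P hx hx)
  have hbM : b ≤ M := (le_abs_self _).trans (abs_pcovSqExplicit_le P hy hy)
  -- If ab = 0 then σ = 0, and the right-hand side is 10.
  rcases (mul_nonneg ha0 hb0).eq_or_lt with hab | hab
  · have : sigma a b = 0 := by
      rcases mul_eq_zero.1 hab.symm with h | h <;> simp [sigma, h]
    rw [this]
    refine measureReal_le_one.trans ?_
    norm_num
  have hapos : 0 < a := pos_of_mul_pos_left hab hb0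
  have hbpos : 0 < b := pos_of_mul_pos_right hab ha0
  have hDsq : (√a * √b) ^ 2 = a * b := by
    rw [mul_pow, Real.sq_sqrt ha0, Real.sq_sqrt hb0]
  have hM := M_pos
  have hD : 0 < √a * √b := mul_pos (Real.sqrt_pos.2 hapos) (Real.sqrt_pos.2 hbpos)
  have hindepX : iIndepFun (fun i ω => (X i ω, X i ω)) P' :=
    hindep.comp (fun _ z => (z.1, z.1)) fun _ => by fun_prop
  have hindepY : iIndepFun (fun i ω => (Y i ω, Y i ω)) P' :=
    hindep.comp (fun _ z => (z.2, z.2)) fun _ => by fun_prop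
  have hidentX : ∀ i, IdentDistrib (fun ω => (X i ω, X i ω)) (fun ω => (x ω, x ω)) P' P :=
    fun i => (hident i).comp (u := fun z : E p × E q => (z.1, z.1)) (by fun_prop)
  have hidentY : ∀ i, IdentDistrib (fun ω => (Y i ω, Y i ω)) (fun ω => (y ω, y ω)) P' P :=
    fun i => (hident i).comp (u := fun z : E p × E q => (z.2, z.2)) (by fun_prop)
  have h₁ := measureReal_samplePcovSq_sub_gt_le hn hindep hident hx hy
    (ε := ε * (√a * √b) / 2) (by positivity)
  have h₂ := measureReal_samplePcovSq_sub_gt_le hn hindepX hidentX hx hx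
    (ε := ε * (a * b) / (4 * M)) (by positivity)
  have h₃ := measureReal_samplePcovSq_sub_gt_le hn hindepY hidentY hy hy
    (ε := ε * (a * b) / (4 * M)) (by positivity)
  -- The second entry (ab)²/(4M⁴) of the minimum suffices. Since M² ≥ 4 and ab ≤ M², it is at most
  -- both ab/4 and (ab)²/(16M²), the squared relative deviations allowed to the numerator and to the
  -- variances.
  have hs1 : sigma a b ≤ (a * b) ^ 2 / (4 * M ^ 4) :=
    (min_le_right _ _).trans (le_of_eq (by rw [mul_pow]))
  have habM : a * b ≤ M ^ 2 := by
    rw [sq]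
    exact mul_le_mul haM hbM hb0 hM.le
  have hM2 : 4 ≤ M ^ 2 := by nlinarith [two_le_M]
  have hs2 : sigma a b * ε ^ 2 ≤ (ε * (√a * √b) / 2) ^ 2 := by
    have : (a * b) ^ 2 / (4 * M ^ 4) ≤ a * b / 4 := by
      rw [div_le_div_iff₀ (by positivity) (by norm_num)]
      have : a * b ≤ M ^ 4 := habM.trans (by nlinarith)
      nlinarith
    calc _ ≤ a * b / 4 * ε ^ 2 := by gcongr; exact hs1.trans this
      _ = _ := by rw [← hDsq]; ring
  have hs3 : sigma a b * ε ^ 2 ≤ (ε * (a * b) / (4 * M)) ^ 2 := by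
    have : (a * b) ^ 2 / (4 * M ^ 4) ≤ (a * b) ^ 2 / (16 * M ^ 2) := by
      refine div_le_div_of_nonneg_left (by positivity) (by positivity) ?_
      nlinarith [sq_nonneg M]
    calc _ ≤ (a * b) ^ 2 / (16 * M ^ 2) * ε ^ 2 := by gcongr; exact hs1.trans this
      _ = _ := by ring
  have hexp : ∀ {δ : ℝ}, sigma a b * ε ^ 2 ≤ δ ^ 2 →
      2 * Real.exp (-((800 * M ^ 2)⁻¹ * n * δ ^ 2)) ≤
        2 * Real.exp (-((800 * M ^ 2)⁻¹ * sigma a b * n * ε ^ 2)) := fun {δ} h => by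
    refine mul_le_mul_of_nonneg_left (Real.exp_le_exp.2 (neg_le_neg ?_)) zero_le_two
    calc (800 * M ^ 2)⁻¹ * sigma a b * n * ε ^ 2
        = (800 * M ^ 2)⁻¹ * n * (sigma a b * ε ^ 2) := by ring
      _ ≤ _ := mul_le_mul_of_nonneg_left h (by positivity)
  have hsub : {ω | ε < |corrSq (samplePcovSq (fun i => X i ω) (fun i => Y i ω))
          (samplePcovSq (fun i => X i ω) (fun i => X i ω))
          (samplePcovSq (fun i => Y i ω) (fun i => Y i ω)) - corrSq (pcovSqExplicit P x y) a b|} ⊆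
      ({ω | ε * (√a * √b) / 2 <
          |samplePcovSq (fun i => X i ω) (fun i => Y i ω) - pcovSqExplicit P x y|} ∪
        {ω | ε * (a * b) / (4 * M) <
          |samplePcovSq (fun i => X i ω) (fun i => X i ω) - a|}) ∪
        {ω | ε * (a * b) / (4 * M) <
          |samplePcovSq (fun i => Y i ω) (fun i => Y i ω) - b|} := fun ω hω => by
    by_contra hcon
    simp only [Set.mem_union, Set.mem_ofPred_eq, not_or, not_lt] at hcon
    exact absurd (abs_corrSq_sub_le (samplePcovSq_self_nonneg _)
      ((le_abs_self _).trans (abs_samplePcovSq_le hn _ _)) (samplePcovSq_self_nonneg _) hapos hbpos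
      hbM (abs_samplePcovSq_le_sqrt _ _) hcon.1.1 hcon.1.2 hcon.2) (not_le.2 hω)
  -- Three events of probability at most 2e each give 6e, within the allowed 10e.
  have hu := (measureReal_mono hsub).trans ((measureReal_union_le (μ := P') _ _).trans
    (add_le_add_left (measureReal_union_le (μ := P') _ _) _))
  have e := Real.exp_pos (-((800 * M ^ 2)⁻¹ * sigma a b * n * ε ^ 2))
  linarith [h₁.trans (hexp hs2), h₂.trans (hexp hs3), h₃.trans (hexp hs3)]

end Concentration

/-! ### Invariance and null sets of the measure on directions -/

section Sphere

variable {p : ℕ}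

theorem sphereMeasure_univ (hp : p ≠ 0) :
    sphereMeasure p Set.univ = ENNReal.ofReal (2 * Real.pi) := by
  have : Nonempty (Fin p) := ⟨⟨0, Nat.pos_of_ne_zero hp⟩⟩
  have : Nontrivial (E p) := inferInstance
  rw [sphereMeasure, Measure.smul_apply, smul_eq_mul, mul_assoc, ENNReal.inv_mul_cancel, mul_one]
  · rw [Ne, Measure.measure_univ_eq_zero]
    exact Measure.toSphere_ne_zero _
  · exact measure_ne_top _ _

instance : IsFiniteMeasure (sphereMeasure p) := by
  refine ⟨?_⟩
  rcases eq_or_ne p 0 with rfl | hp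
  -- In dimension zero the scaling factor is infinite, but the sphere is empty.
  · have : IsEmpty (Metric.sphere (0 : E 0) 1) := by
      refine ⟨fun α => ?_⟩
      have h := norm_eq_of_mem_sphere α
      rw [Subsingleton.elim (α : E 0) 0, norm_zero] at h
      exact zero_ne_one h
    rw [Set.eq_empty_of_isEmpty Set.univ, measure_empty]
    exact ENNReal.zero_lt_top
  · rw [sphereMeasure_univ hp]
    exact ENNReal.ofReal_lt_top

theorem sphereMeasure_real_univ (hp : p ≠ 0) : (sphereMeasure p).real Set.univ = 2 * Real.pi := by
  rw [measureReal_def, sphereMeasure_univ hp, ENNReal.toReal_ofReal (by positivity)]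

/-- Surface measure is p times the volume of the cone below the set, so invariance and null sets can
be read off from Lebesgue measure. -/
theorem sphereMeasure_apply {s : Set (E p)} (hs : MeasurableSet s) :
    sphereMeasure p {α | (α : E p) ∈ s} =
      ENNReal.ofReal (2 * Real.pi) * ((volume : Measure (E p)).toSphere Set.univ)⁻¹ *
        (p * volume (Set.image2 (fun (r : ℝ) (a : E p) => r • a) (Set.Ioo 0 1)
          (s ∩ Metric.sphere 0 1))) := by
  rw [sphereMeasure, Measure.smul_apply, smul_eq_mul]
  refine congrArg _ ((Measure.toSphere_apply' _ (measurable_subtype_coe hs)).trans ?_)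
  rw [finrank_euclideanSpace_fin, ← Set.image2_smul, Subtype.image_preimage_coe, Set.inter_comm]

/-- A linear isometry preserves volume and carries cones over subsets of the sphere to such cones.
-/
theorem sphereMeasure_preimage (L : E p ≃ₗᵢ[ℝ] E p) {s : Set (E p)} (hs : MeasurableSet s) :
    sphereMeasure p {α | L (α : E p) ∈ s} = sphereMeasure p {α | (α : E p) ∈ s} := by
  rw [sphereMeasure_apply hs]
  refine (sphereMeasure_apply (L.continuous.measurable hs)).trans ?_
  congr 2
  rw [eq_comm, ← L.measurePreserving.measure_preimage_emb L.toHomeomorph.measurableEmbedding]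
  congr 1
  ext a
  simp only [Set.mem_image2, Set.mem_inter_iff, Set.mem_preimage, mem_sphere_zero_iff_norm]
  constructor
  · rintro ⟨r, hr, b, ⟨hb, hb1⟩, h⟩
    refine ⟨r, hr, L.symm b, ⟨by simpa using hb, by rwa [L.symm.norm_map]⟩, L.injective ?_⟩
    rw [← h]
    simp
  · rintro ⟨r, hr, b, ⟨hb, hb1⟩, rfl⟩
    exact ⟨r, hr, L b, ⟨hb, by rwa [L.norm_map]⟩, by simp⟩

/-- The cone lies in the hyperplane orthogonal to u, which has volume zero. -/
theorem sphereMeasure_inner_eq_zero {u : E p} (hu : u ≠ 0) :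
    sphereMeasure p {α | inner ℝ (α : E p) u = 0} = 0 := by
  have hs : MeasurableSet {a : E p | inner ℝ a u = 0} :=
    measurableSet_eq_fun (by fun_prop) measurable_const
  have h := sphereMeasure_apply hs
  have h0 : volume (Set.image2 (fun (r : ℝ) (a : E p) => r • a) (Set.Ioo 0 1)
      ({a : E p | inner ℝ a u = 0} ∩ Metric.sphere 0 1)) = 0 := by
    refine measure_mono_null (t := ((ℝ ∙ u)ᗮ : Submodule ℝ (E p))) ?_
      (Measure.addHaar_submodule _ _ ?_)
    · rintro _ ⟨r, -, a, ⟨ha, -⟩, rfl⟩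
      refine Submodule.smul_mem _ _ ?_
      rw [Submodule.mem_orthogonal_singleton_iff_inner_left]
      exact ha
    · intro htop
      have : u ∈ (ℝ ∙ u)ᗮ := by rw [htop]; trivial
      rw [Submodule.mem_orthogonal_singleton_iff_inner_left, inner_self_eq_zero] at this
      exact hu this
  rw [h0, mul_zero, mul_zero] at h
  exact h

/-- The antipodal map exchanges the two closed half-spaces; they cover the sphere and overlap in a
null set, so each has half the total mass 2π. -/
theorem sphereMeasure_halfspace (hp : p ≠ 0) {u : E p} (hu : u ≠ 0) :
    (sphereMeasure p).real {α | inner ℝ (α : E p) u ≤ 0} = Real.pi := by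
  set S := sphereMeasure p
  have hm : MeasurableSet {a : E p | inner ℝ a u ≤ 0} :=
    measurableSet_le (by fun_prop) measurable_const
  have hsymm : S.real {α | inner ℝ (α : E p) u ≤ 0} = S.real {α | 0 ≤ inner ℝ (α : E p) u} := by
    rw [measureReal_def, measureReal_def]
    congr 1
    refine (sphereMeasure_preimage (LinearIsometryEquiv.neg ℝ) hm).symm.trans ?_
    simp [S]
  have hunion : S.real ({α | inner ℝ (α : E p) u ≤ 0} ∪ {α | 0 ≤ inner ℝ (α : E p) u}) +
      S.real ({α | inner ℝ (α : E p) u ≤ 0} ∩ {α | 0 ≤ inner ℝ (α : E p) u}) =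
      S.real {α | inner ℝ (α : E p) u ≤ 0} + S.real {α | 0 ≤ inner ℝ (α : E p) u} :=
    measureReal_union_add_inter (measurableSet_le measurable_const (by fun_prop))
  have h1 : ({α | inner ℝ (α : E p) u ≤ 0} ∪ {α | 0 ≤ inner ℝ (α : E p) u} :
      Set (Metric.sphere (0 : E p) 1)) = Set.univ :=
    Set.eq_univ_of_forall fun α => le_total (inner ℝ (α : E p) u) 0
  have h2 : ({α | inner ℝ (α : E p) u ≤ 0} ∩ {α | 0 ≤ inner ℝ (α : E p) u} :
      Set (Metric.sphere (0 : E p) 1)) =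
      ({α | inner ℝ (α : E p) u = 0} : Set (Metric.sphere (0 : E p) 1)) :=
    Set.ext fun α => (le_antisymm_iff (a := inner ℝ (α : E p) u) (b := 0)).symm
  rw [h1, h2, sphereMeasure_real_univ hp, measureReal_def, sphereMeasure_inner_eq_zero hu] at hunion
  simp at hunion
  linarith

end Sphere

/-! ### Directions in a wedge, by averaging over plane rotations -/

section Wedge

theorem measurableSet_nonpos_and_nonpos {α : Type*} [MeasurableSpace α] {f g : α → ℝ}
    (hf : Measurable f) (hg : Measurable g) : MeasurableSet {a | f a ≤ 0 ∧ g a ≤ 0} :=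
  (measurableSet_le hf measurable_const).inter (measurableSet_le hg measurable_const)

variable {p : ℕ}

/-- The length of the set of planar directions in the intersection of two half-planes. -/
theorem intervalIntegral_wedge {θ : ℝ} (h0 : 0 ≤ θ) (hπ : θ ≤ Real.pi) (φ : ℝ) :
    ∫ t in (0 : ℝ)..2 * Real.pi,
      (if Real.cos (t + φ) ≤ 0 ∧ Real.cos (t - θ + φ) ≤ 0 then (1 : ℝ) else 0) = Real.pi - θ := by
  set f : ℝ → ℝ := fun s => if Real.cos s ≤ 0 ∧ Real.cos (s - θ) ≤ 0 then 1 else 0 with hf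
  have hper : Function.Periodic f (2 * Real.pi) := fun s => by
    simp only [hf]
    rw [Real.cos_add_two_pi, show s + 2 * Real.pi - θ = s - θ + 2 * Real.pi by ring,
      Real.cos_add_two_pi]
  have hπ0 := Real.pi_pos
  calc _ = ∫ t in (0 : ℝ)..2 * Real.pi, f (t + φ) := by
        congr 1
        ext t
        simp only [hf, show t + φ - θ = t - θ + φ by ring]
    _ = ∫ s in (0 + φ)..(2 * Real.pi + φ), f s := by
        rw [intervalIntegral.integral_comp_add_right]
    -- Periodicity allows the window to start at π/2. Inside it, cos s ≤ 0 means s ≤ 3π/2, and cos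
    -- (s - θ) ≤ 0 then means s ≥ π/2 + θ: an interval of length π - θ.
    _ = ∫ s in (Real.pi / 2)..(Real.pi / 2 + 2 * Real.pi), f s := by
        rw [zero_add, add_comm (2 * Real.pi) φ]
        exact hper.intervalIntegral_add_eq φ (Real.pi / 2)
    _ = ∫ s in Set.Icc (Real.pi / 2) (Real.pi / 2 + 2 * Real.pi),
          (Set.Icc (Real.pi / 2 + θ) (Real.pi + Real.pi / 2)).indicator 1 s := by
        rw [intervalIntegral.integral_of_le (by linarith), integral_Ioc_eq_integral_Ioo,
          integral_Icc_eq_integral_Ioo]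
        refine setIntegral_congr_fun measurableSet_Ioo fun s hs => ?_
        simp only [hf, Set.indicator_apply, Set.mem_Icc, Pi.one_apply]
        refine if_congr ⟨fun h => ?_, fun h => ⟨?_, ?_⟩⟩ rfl rfl
        · have hs2 : s ≤ Real.pi + Real.pi / 2 := by
            by_contra hcon
            push Not at hcon
            have : 0 < Real.cos (s - 2 * Real.pi) := Real.cos_pos_of_mem_Ioo
              ⟨by linarith, by linarith [hs.2]⟩
            rw [Real.cos_sub_two_pi] at this
            linarith [h.1]
          refine ⟨?_, hs2⟩
          by_contra hcon
          push Not at hcon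
          have : 0 < Real.cos (s - θ) := Real.cos_pos_of_mem_Ioo
            ⟨by linarith [hs.1], by linarith⟩
          linarith [h.2]
        · exact Real.cos_nonpos_of_pi_div_two_le_of_le hs.1.le h.2
        · exact Real.cos_nonpos_of_pi_div_two_le_of_le (by linarith [h.1]) (by linarith [h.2])
    _ = Real.pi - θ := by
        rw [setIntegral_indicator measurableSet_Icc, Pi.one_def, setIntegral_const, smul_eq_mul,
          mul_one, Set.inter_eq_self_of_subset_right, Real.volume_real_Icc_of_le (by linarith)]
        · ring
        · exact Set.Icc_subset_Icc (by linarith) (by linarith)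

/-- Rotation by the angle `t` in the plane spanned by the orthonormal pair `b`, `c`. -/
noncomputable def planeRotation (b c : E p) (t : ℝ) : E p →ₗ[ℝ] E p :=
  LinearMap.id + ((Real.cos t - 1) • (innerₛₗ ℝ b) - Real.sin t • (innerₛₗ ℝ c)).smulRight b +
    ((Real.cos t - 1) • (innerₛₗ ℝ c) + Real.sin t • (innerₛₗ ℝ b)).smulRight c

theorem planeRotation_apply (b c : E p) (t : ℝ) (a : E p) :
    planeRotation b c t a =
      a + ((Real.cos t - 1) * inner ℝ b a - Real.sin t * inner ℝ c a) • b +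
        ((Real.cos t - 1) * inner ℝ c a + Real.sin t * inner ℝ b a) • c := by
  simp [planeRotation]

theorem exists_planeRotation {b c : E p} (hb : ‖b‖ = 1) (hc : ‖c‖ = 1) (hbc : inner ℝ b c = 0)
    (t : ℝ) : ∃ L : E p ≃ₗᵢ[ℝ] E p, ∀ a, L a = planeRotation b c t a := by
  have hbb : inner ℝ b b = (1 : ℝ) := by rw [real_inner_self_eq_norm_sq, hb, one_pow]
  have hcc : inner ℝ c c = (1 : ℝ) := by rw [real_inner_self_eq_norm_sq, hc, one_pow]
  have hcb : inner ℝ c b = (0 : ℝ) := by rw [real_inner_comm, hbc]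
  let L₀ : E p →ₗᵢ[ℝ] E p := ⟨planeRotation b c t, fun a => by
    rw [← sq_eq_sq₀ (norm_nonneg _) (norm_nonneg _), ← real_inner_self_eq_norm_sq,
      ← real_inner_self_eq_norm_sq, planeRotation_apply]
    simp only [inner_add_left, inner_add_right, inner_smul_left, inner_smul_right, hbb, hcc, hbc,
      hcb, real_inner_comm b a, real_inner_comm c a, RCLike.conj_to_real]
    linear_combination ((inner ℝ b a) ^ 2 + (inner ℝ c a) ^ 2) * Real.sin_sq_add_cos_sq t⟩
  exact ⟨L₀.toLinearIsometryEquiv rfl, fun a => rfl⟩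

/-- Rotating the wedge by t in the plane of b and c keeps its measure w. Integrating over a full
turn gives 2πw. By Fubini it also equals the integral over α of the time α spends in the rotating
wedge, which is π - θ for almost every α. The total mass is 2π as well, so w = π - θ. -/
theorem sphereMeasure_wedge_orthonormal (hp : p ≠ 0) {b c : E p} (hb : ‖b‖ = 1) (hc : ‖c‖ = 1)
    (hbc : inner ℝ b c = 0) {θ : ℝ} (h0 : 0 ≤ θ) (hπ : θ ≤ Real.pi) :
    (sphereMeasure p).real {α | inner ℝ (α : E p) b ≤ 0 ∧
      inner ℝ (α : E p) (Real.cos θ • b + Real.sin θ • c) ≤ 0} = Real.pi - θ := by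
  have hbb : inner ℝ b b = (1 : ℝ) := by rw [real_inner_self_eq_norm_sq, hb, one_pow]
  have hcc : inner ℝ c c = (1 : ℝ) := by rw [real_inner_self_eq_norm_sq, hc, one_pow]
  have hcb : inner ℝ c b = (0 : ℝ) := by rw [real_inner_comm, hbc]
  set S := sphereMeasure p with hS
  -- `W t` is the preimage of the wedge under rotation by t, in the coordinates of α along b and c.
  set W : ℝ → Set (Metric.sphere (0 : E p) 1) := fun t => {α |
    Real.cos t * inner ℝ (α : E p) b - Real.sin t * inner ℝ (α : E p) c ≤ 0 ∧
    Real.cos (t - θ) * inner ℝ (α : E p) b - Real.sin (t - θ) * inner ℝ (α : E p) c ≤ 0} with hW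
  set w := S.real {α | inner ℝ (α : E p) b ≤ 0 ∧
      inner ℝ (α : E p) (Real.cos θ • b + Real.sin θ • c) ≤ 0} with hw
  have hrot : ∀ t, S.real (W t) = w := fun t => by
    obtain ⟨L, hL⟩ := exists_planeRotation hb hc hbc t
    have hm : MeasurableSet {a : E p | inner ℝ a b ≤ 0 ∧
        inner ℝ a (Real.cos θ • b + Real.sin θ • c) ≤ 0} :=
      measurableSet_nonpos_and_nonpos (by fun_prop) (by fun_prop)
    rw [hw, measureReal_def, measureReal_def]
    congr 1
    refine Eq.trans ?_ (sphereMeasure_preimage L hm)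
    congr 1
    ext α
    simp only [hW, Set.mem_ofPred_eq, hL, planeRotation_apply, inner_add_left, inner_add_right,
      inner_smul_left, inner_smul_right, hbb, hcc, hbc, hcb, RCLike.conj_to_real,
      real_inner_comm b (α : E p), real_inner_comm c (α : E p), Real.cos_sub, Real.sin_sub]
    refine and_congr (iff_of_eq ?_) (iff_of_eq ?_)
    · congr 1; ring
    · congr 1; ring
  set I : ℝ → Metric.sphere (0 : E p) 1 → ℝ := fun t => (W t).indicator fun _ => 1 with hI
  have hcov : Measurable (Function.uncurry I) := by
    have : MeasurableSet {z : ℝ × Metric.sphere (0 : E p) 1 | z.2 ∈ W z.1} :=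
      measurableSet_nonpos_and_nonpos (by fun_prop) (by fun_prop)
    exact measurable_const.indicator this
  have hnull : ∀ᵐ α : Metric.sphere (0 : E p) 1 ∂S, inner ℝ (α : E p) b ≠ 0 := by
    have := sphereMeasure_inner_eq_zero (norm_ne_zero_iff.1 (hb.trans_ne one_ne_zero))
    simpa [ae_iff] using this
  have hinner : ∀ᵐ α ∂S, ∫ t in (0 : ℝ)..2 * Real.pi, I t α =
      Real.pi - θ := by
    filter_upwards [hnull] with α hα
    -- Polar form of the projection of α to the plane. It is nonzero for almost every α, and its
    -- modulus does not affect the signs.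
    set ζ : ℂ := ⟨inner ℝ (α : E p) b, inner ℝ (α : E p) c⟩ with hζ
    have hζ0 : 0 < ‖ζ‖ := norm_pos_iff.2 fun h => hα (congrArg Complex.re h)
    have hre : inner ℝ (α : E p) b = ‖ζ‖ * Real.cos ζ.arg := (Complex.norm_mul_cos_arg ζ).symm
    have him : inner ℝ (α : E p) c = ‖ζ‖ * Real.sin ζ.arg := (Complex.norm_mul_sin_arg ζ).symm
    rw [← intervalIntegral_wedge h0 hπ ζ.arg]
    congr 1
    ext t
    simp only [hI, Set.indicator_apply]
    refine if_congr ?_ rfl rfl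
    have key : ∀ s, Real.cos s * inner ℝ (α : E p) b - Real.sin s * inner ℝ (α : E p) c ≤ 0 ↔
        Real.cos (s + ζ.arg) ≤ 0 := fun s => by
      rw [hre, him, Real.cos_add, show Real.cos s * (‖ζ‖ * Real.cos ζ.arg) -
        Real.sin s * (‖ζ‖ * Real.sin ζ.arg) = ‖ζ‖ * (Real.cos s * Real.cos ζ.arg -
        Real.sin s * Real.sin ζ.arg) by ring]
      exact ⟨fun h => nonpos_of_mul_nonpos_right h hζ0,
        fun h => mul_nonpos_of_nonneg_of_nonpos hζ0.le h⟩
    exact and_congr (key t) (key (t - θ))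
  have hswap : ∫ t in (0 : ℝ)..2 * Real.pi, ∫ α, I t α ∂S =
      ∫ α, (∫ t in (0 : ℝ)..2 * Real.pi, I t α) ∂S := by
    simp only [intervalIntegral.integral_of_le Real.two_pi_pos.le]
    refine integral_integral_swap ?_
    refine Integrable.of_bound (C := 1) hcov.aestronglyMeasurable
      (Filter.Eventually.of_forall fun z => ?_)
    simp only [Function.uncurry, hI, Set.indicator_apply]
    split_ifs <;> simp
  have hWm : ∀ t, MeasurableSet (W t) := fun t =>
    measurableSet_nonpos_and_nonpos (by fun_prop) (by fun_prop)
  rw [integral_congr_ae hinner] at hswap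
  simp only [hI, integral_indicator_const _ (hWm _), hrot, integral_const, smul_eq_mul, mul_one,
    intervalIntegral.integral_const, sub_zero] at hswap
  rw [hS, sphereMeasure_real_univ hp] at hswap
  exact mul_left_cancel₀ Real.two_pi_pos.ne' hswap

end Wedge

/-! ### Wedges of arbitrary nonzero vectors -/

section GeneralWedge

variable {p : ℕ}

theorem inner_nonpos_iff_normalize {u : E p} (hu : u ≠ 0) (a : E p) :
    inner ℝ a u ≤ 0 ↔ inner ℝ a (‖u‖⁻¹ • u) ≤ 0 := by
  have h : 0 < ‖u‖⁻¹ := inv_pos.2 (norm_pos_iff.2 hu)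
  rw [inner_smul_right]
  exact ⟨fun h' => mul_nonpos_of_nonneg_of_nonpos h.le h', fun h' => nonpos_of_mul_nonpos_right h' h⟩

/-- Gram-Schmidt writes d = cos θ b + sin θ c with θ = arccos ⟨b, d⟩. For d = ±b there is no c, and
the wedge is a half-space or a null great subsphere. -/
theorem sphereMeasure_wedge_unit (hp : p ≠ 0) {b d : E p} (hb : ‖b‖ = 1) (hd : ‖d‖ = 1) :
    (sphereMeasure p).real {α | inner ℝ (α : E p) b ≤ 0 ∧ inner ℝ (α : E p) d ≤ 0} =
      Real.pi - Real.arccos (inner ℝ b d) := by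
  have hb0 : b ≠ 0 := norm_ne_zero_iff.1 (hb.trans_ne one_ne_zero)
  have hbb : inner ℝ b b = (1 : ℝ) := by rw [real_inner_self_eq_norm_sq, hb, one_pow]
  have hdd : inner ℝ d d = (1 : ℝ) := by rw [real_inner_self_eq_norm_sq, hd, one_pow]
  set κ : ℝ := inner ℝ b d with hκ
  have hκabs : |κ| ≤ 1 := by simpa [hb, hd] using abs_real_inner_le_norm b d
  have hκ1 := abs_le.1 hκabs
  have hw : ‖d - κ • b‖ ^ 2 = 1 - κ ^ 2 := by
    rw [← real_inner_self_eq_norm_sq]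
    simp only [inner_sub_left, inner_sub_right, inner_smul_left, inner_smul_right, hbb, hdd,
      real_inner_comm b d, ← hκ, RCLike.conj_to_real]
    ring
  rcases eq_or_ne (d - κ • b) 0 with h0 | h0
  · have hd' : d = κ • b := sub_eq_zero.1 h0
    rw [h0, norm_zero] at hw
    have hsq : (κ - 1) * (κ + 1) = 0 := by linarith
    rcases mul_eq_zero.1 hsq with h | h
    · have h1 : κ = 1 := by linarith
      rw [h1, one_smul] at hd'
      rw [h1, Real.arccos_one, sub_zero, ← sphereMeasure_halfspace hp hb0, hd']
      simp only [and_self]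
    · have h1 : κ = -1 := by linarith
      rw [h1, neg_smul, one_smul] at hd'
      rw [h1, Real.arccos_neg_one, sub_self, hd', measureReal_def]
      have : {α : Metric.sphere (0 : E p) 1 | inner ℝ (α : E p) b ≤ 0 ∧
          inner ℝ (α : E p) (-b) ≤ 0} =
          ({α | inner ℝ (α : E p) b = 0} : Set (Metric.sphere (0 : E p) 1)) := by
        ext α
        simp only [Set.mem_ofPred_eq, inner_neg_right, Left.neg_nonpos_iff]
        exact (le_antisymm_iff (a := inner ℝ (α : E p) b) (b := 0)).symm
      rw [this, sphereMeasure_inner_eq_zero hb0, ENNReal.toReal_zero]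
  · have hpos : 0 < ‖d - κ • b‖ := norm_pos_iff.2 h0
    have hsin : Real.sin (Real.arccos κ) = ‖d - κ • b‖ := by
      rw [Real.sin_arccos, ← hw, Real.sqrt_sq hpos.le]
    have hcos : Real.cos (Real.arccos κ) = κ := Real.cos_arccos hκ1.1 hκ1.2
    have h := sphereMeasure_wedge_orthonormal hp (b := b) (c := ‖d - κ • b‖⁻¹ • (d - κ • b)) hb
      (by rw [norm_smul, norm_inv, norm_norm, inv_mul_cancel₀ hpos.ne'])
      (by rw [inner_smul_right, inner_sub_right, inner_smul_right, hbb, ← hκ]; ring)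
      (Real.arccos_nonneg κ) (Real.arccos_le_pi κ)
    rw [hsin, hcos, smul_inv_smul₀ hpos.ne', add_sub_cancel] at h
    exact h

/-- The measure of the directions making nonpositive products with two given vectors. -/
theorem sphereMeasure_wedge (hp : p ≠ 0) {u v : E p} (hu : u ≠ 0) (hv : v ≠ 0) :
    (sphereMeasure p).real {α | inner ℝ (α : E p) u ≤ 0 ∧ inner ℝ (α : E p) v ≤ 0} =
      Real.pi - Real.arccos (inner ℝ u v / (‖u‖ * ‖v‖)) := by
  have h := sphereMeasure_wedge_unit hp (b := ‖u‖⁻¹ • u) (d := ‖v‖⁻¹ • v)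
    (norm_smul_inv_norm hu) (norm_smul_inv_norm hv)
  simp only [← inner_nonpos_iff_normalize hu, ← inner_nonpos_iff_normalize hv] at h
  rw [h, inner_smul_left, inner_smul_right, RCLike.conj_to_real]
  congr 2
  field_simp

theorem sphereMeasure_le_and_le (hp : p ≠ 0) {u v w : E p} (hu : u ≠ w) (hv : v ≠ w) :
    (sphereMeasure p).real {α | inner ℝ (α : E p) u ≤ inner ℝ (α : E p) w ∧
      inner ℝ (α : E p) v ≤ inner ℝ (α : E p) w} = Real.pi - arccosAngle u v w := by
  rw [arccosAngle, ← sphereMeasure_wedge hp (sub_ne_zero.2 hu) (sub_ne_zero.2 hv)]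
  simp only [inner_sub_right, sub_nonpos]

end GeneralWedge

/-! ### Squared covariances of indicators over five copies -/

section Law

/-- The indicator of `s ≤ t`. -/
noncomputable def leInd (s t : ℝ) : ℝ := if s ≤ t then 1 else 0

theorem abs_leInd_le (s t : ℝ) : |leInd s t| ≤ 1 := by
  unfold leInd
  split_ifs <;> simp

theorem leInd_mul_leInd (s t s' t' : ℝ) :
    leInd s t * leInd s' t' = if s ≤ t ∧ s' ≤ t' then 1 else 0 := by
  unfold leInd
  split_ifs <;> simp_all

theorem measurable_leInd {α : Type*} [MeasurableSpace α] {f g : α → ℝ} (hf : Measurable f)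
    (hg : Measurable g) : Measurable fun a => leInd (f a) (g a) :=
  Measurable.ite (measurableSet_le hf hg) measurable_const measurable_const

variable {Ω : Type*} [MeasurableSpace Ω] (P : Measure Ω)

theorem integral_ite_one_zero {Z : Type*} [MeasurableSpace Z] (μ : Measure Z) {s : Set Z}
    (hs : MeasurableSet s) [DecidablePred (· ∈ s)] :
    ∫ z, (if z ∈ s then (1 : ℝ) else 0) ∂μ = μ.real s := by
  rw [← integral_indicator_one hs]
  congr 1
  ext z
  simp [Set.indicator_apply]

theorem distFun_eq_integral {U : Ω → ℝ} {Z : Type*} [MeasurableSpace Z] {z : Ω → Z}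
    (hz : AEMeasurable z P) {f : Z → ℝ} (hf : Measurable f) (hU : ∀ ω, U ω = f (z ω)) (u : ℝ) :
    distFun P U u = ∫ w, leInd (f w) u ∂(P.map z) := by
  classical
  have hs : MeasurableSet {w | f w ≤ u} := measurableSet_le hf measurable_const
  have h := integral_ite_one_zero (P.map z) hs
  rw [map_measureReal_apply_of_aemeasurable hz hs] at h
  rw [distFun, show U = fun ω => f (z ω) from funext hU]
  exact h.symm

theorem jointDistFun_eq_integral {U V : Ω → ℝ} {Z : Type*} [MeasurableSpace Z] {z : Ω → Z}
    (hz : AEMeasurable z P) {f g : Z → ℝ} (hf : Measurable f) (hg : Measurable g)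
    (hU : ∀ ω, U ω = f (z ω)) (hV : ∀ ω, V ω = g (z ω)) (u v : ℝ) :
    jointDistFun P U V u v = ∫ w, leInd (f w) u * leInd (g w) v ∂(P.map z) := by
  classical
  have hs : MeasurableSet {w | f w ≤ u ∧ g w ≤ v} :=
    (measurableSet_le hf measurable_const).inter (measurableSet_le hg measurable_const)
  have h := integral_ite_one_zero (P.map z) hs
  rw [map_measureReal_apply_of_aemeasurable hz hs] at h
  rw [jointDistFun, show U = fun ω => f (z ω) from funext hU,
    show V = fun ω => g (z ω) from funext hV]
  refine h.symm.trans ?_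
  congr 1
  ext w
  rw [leInd_mul_leInd]
  exact if_congr Iff.rfl rfl rfl

/-- The dependence measure in terms of the law of a random element carrying both variables. -/
theorem cvmDependence_eq_integral [IsProbabilityMeasure P] {U V : Ω → ℝ} {Z : Type*} [MeasurableSpace Z] {z : Ω → Z}
    (hz : AEMeasurable z P) {f g : Z → ℝ} (hf : Measurable f) (hg : Measurable g)
    (hU : ∀ ω, U ω = f (z ω)) (hV : ∀ ω, V ω = g (z ω)) :
    cvmDependence P U V = ∫ w, (∫ a, leInd (f a) (f w) * leInd (g a) (g w) ∂(P.map z) -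
      (∫ a, leInd (f a) (f w) ∂(P.map z)) * ∫ a, leInd (g a) (g w) ∂(P.map z)) ^ 2
      ∂(P.map z) := by
  have : IsProbabilityMeasure (P.map z) := Measure.isProbabilityMeasure_map hz
  have hmap : P.map (fun ω => (U ω, V ω)) = (P.map z).map fun w => (f w, g w) := by
    rw [AEMeasurable.map_map_of_aemeasurable (hf.prodMk hg).aemeasurable hz]
    congr 1
    ext ω <;> simp [hU, hV]
  rw [cvmDependence, hmap]
  simp only [jointDistFun_eq_integral P hz hf hg hU hV, distFun_eq_integral P hz hf hU,
    distFun_eq_integral P hz hg hV]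
  refine integral_map (hf.prodMk hg).aemeasurable (Measurable.aestronglyMeasurable ?_)
  have h1 : Measurable fun w : ℝ × ℝ => ∫ a, leInd (f a) w.1 ∂(P.map z) :=
    (StronglyMeasurable.integral_prod_right' (f := fun t : (ℝ × ℝ) × Z => leInd (f t.2) t.1.1)
      (measurable_leInd (by fun_prop) (by fun_prop)).stronglyMeasurable).measurable
  have h2 : Measurable fun w : ℝ × ℝ => ∫ a, leInd (g a) w.2 ∂(P.map z) :=
    (StronglyMeasurable.integral_prod_right' (f := fun t : (ℝ × ℝ) × Z => leInd (g t.2) t.1.2)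
      (measurable_leInd (by fun_prop) (by fun_prop)).stronglyMeasurable).measurable
  have h3 : Measurable fun w : ℝ × ℝ => ∫ a, leInd (f a) w.1 * leInd (g a) w.2 ∂(P.map z) :=
    (StronglyMeasurable.integral_prod_right'
      (f := fun t : (ℝ × ℝ) × Z => leInd (f t.2) t.1.1 * leInd (g t.2) t.1.2)
      ((measurable_leInd (by fun_prop) (by fun_prop)).mul
        (measurable_leInd (by fun_prop) (by fun_prop))).stronglyMeasurable).measurable
  exact (h3.sub (h1.mul h2)).pow_const 2

/-- The square of a covariance of indicators as an integral over five independent copies. -/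
theorem integral_sq_eq_integral_pi {Z : Type*} [MeasurableSpace Z] (μ : Measure Z)
    [IsProbabilityMeasure μ] {a b : Z → Z → ℝ} (ha : Measurable (Function.uncurry a))
    (hb : Measurable (Function.uncurry b)) (ha1 : ∀ z w, |a z w| ≤ 1) (hb1 : ∀ z w, |b z w| ≤ 1) :
    ∫ w, (∫ z, a z w * b z w ∂μ - (∫ z, a z w ∂μ) * ∫ z, b z w ∂μ) ^ 2 ∂μ =
      ∫ z : Fin 5 → Z, (a (z 0) (z 2) * a (z 3) (z 2)) * (b (z 0) (z 2) * b (z 3) (z 2)) +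
        (a (z 0) (z 2) * a (z 3) (z 2)) * (b (z 1) (z 2) * b (z 4) (z 2)) -
        2 * ((a (z 0) (z 2) * a (z 3) (z 2)) * (b (z 1) (z 2) * b (z 3) (z 2)))
        ∂(Measure.pi fun _ => μ) := by
  set G : (Fin 5 → Z) → ℝ := fun z =>
    (a (z 0) (z 2) * a (z 3) (z 2)) * (b (z 0) (z 2) * b (z 3) (z 2)) +
        (a (z 0) (z 2) * a (z 3) (z 2)) * (b (z 1) (z 2) * b (z 4) (z 2)) -
        2 * ((a (z 0) (z 2) * a (z 3) (z 2)) * (b (z 1) (z 2) * b (z 3) (z 2))) with hG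
  have ham : ∀ i j : Fin 5, Measurable fun z : Fin 5 → Z => a (z i) (z j) := fun i j =>
    ha.comp (f := fun z : Fin 5 → Z => (z i, z j))
      ((measurable_pi_apply i).prodMk (measurable_pi_apply j))
  have hbm : ∀ i j : Fin 5, Measurable fun z : Fin 5 → Z => b (z i) (z j) := fun i j =>
    hb.comp (f := fun z : Fin 5 → Z => (z i, z j))
      ((measurable_pi_apply i).prodMk (measurable_pi_apply j))
  have hGm : Measurable G :=
    (((((ham _ _).mul (ham _ _)).mul ((hbm _ _).mul (hbm _ _)))).add
      (((ham _ _).mul (ham _ _)).mul ((hbm _ _).mul (hbm _ _)))).sub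
      ((((ham _ _).mul (ham _ _)).mul ((hbm _ _).mul (hbm _ _))).const_mul 2)
  have hprod : ∀ {s t : ℝ}, |s| ≤ 1 → |t| ≤ 1 → |s * t| ≤ 1 := fun hs ht => by
    rw [abs_mul]
    exact mul_le_one₀ hs (abs_nonneg _) ht
  have hGb : ∀ z, |G z| ≤ 4 * 1 ^ 2 := fun z => abs_kernel_combination_le
    (hprod (ha1 _ _) (ha1 _ _)) (hprod (hb1 _ _) (hb1 _ _)) (hprod (hb1 _ _) (hb1 _ _))
    (hprod (hb1 _ _) (hb1 _ _))
  -- Relabelling moves the vertex, slot 2, to the first coordinate, where it can be split off and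
  -- frozen as w; slots 0, 1, 3, 4 become the four remaining copies.
  let e : Fin 5 → Fin 5 := ![1, 2, 0, 3, 4]
  have he : Function.Injective e := by decide
  have hem : Measurable fun (z : Fin 5 → Z) i => z (e i) :=
    measurable_pi_lambda _ fun i => measurable_pi_apply (e i)
  rw [← map_pi_comp_injective μ he, integral_map hem.aemeasurable hGm.aestronglyMeasurable]
  refine Eq.trans ?_ (integral_pi_succ μ (hGm.comp hem) (C := 4 * 1 ^ 2)
    fun z => hGb fun i => z (e i)).symm
  congr 1
  ext w
  have haw : Measurable fun z => a z w :=
    ha.comp (f := fun z => (z, w)) (measurable_id.prodMk measurable_const)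
  have hbw : Measurable fun z => b z w :=
    hb.comp (f := fun z => (z, w)) (measurable_id.prodMk measurable_const)
  have hfour : ∀ f₀ f₁ f₂ f₃ : Z → ℝ,
      ∫ z : Fin 4 → Z, f₀ (z 0) * f₁ (z 1) * f₂ (z 2) * f₃ (z 3) ∂(Measure.pi fun _ => μ) =
        (∫ z, f₀ z ∂μ) * (∫ z, f₁ z ∂μ) * (∫ z, f₂ z ∂μ) * ∫ z, f₃ z ∂μ := fun f₀ f₁ f₂ f₃ => by
    have h := integral_fintype_prod_eq_prod (μ := fun _ : Fin 4 => μ)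
      (f := fun i : Fin 4 => (![f₀, f₁, f₂, f₃] i : Z → ℝ))
    simpa [Fin.prod_univ_four] using h
  have hi : ∀ f : (Fin 4 → Z) → ℝ, Measurable f → (∀ z, |f z| ≤ 1) →
      Integrable f (Measure.pi fun _ : Fin 4 => μ) := fun f hf hf1 =>
    Integrable.of_bound (C := 1) hf.aestronglyMeasurable (Filter.Eventually.of_forall hf1)
  set a' : Z → ℝ := fun z => a z w with ha'
  set b' : Z → ℝ := fun z => b z w with hb'
  have ha'm : ∀ i : Fin 4, Measurable fun z : Fin 4 → Z => a' (z i) := fun i =>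
    haw.comp (measurable_pi_apply i)
  have hb'm : ∀ i : Fin 4, Measurable fun z : Fin 4 → Z => b' (z i) := fun i =>
    hbw.comp (measurable_pi_apply i)
  have i1 := hi (fun z => (a' (z 0) * a' (z 2)) * (b' (z 0) * b' (z 2)))
    (((ha'm 0).mul (ha'm 2)).mul ((hb'm 0).mul (hb'm 2)))
    (fun z => hprod (hprod (ha1 _ _) (ha1 _ _)) (hprod (hb1 _ _) (hb1 _ _)))
  have i2 := hi (fun z => (a' (z 0) * a' (z 2)) * (b' (z 1) * b' (z 3)))
    (((ha'm 0).mul (ha'm 2)).mul ((hb'm 1).mul (hb'm 3)))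
    (fun z => hprod (hprod (ha1 _ _) (ha1 _ _)) (hprod (hb1 _ _) (hb1 _ _)))
  have i3 := hi (fun z => (a' (z 0) * a' (z 2)) * (b' (z 1) * b' (z 2)))
    (((ha'm 0).mul (ha'm 2)).mul ((hb'm 1).mul (hb'm 2)))
    (fun z => hprod (hprod (ha1 _ _) (ha1 _ _)) (hprod (hb1 _ _) (hb1 _ _)))
  have v1 := hfour (fun z => a' z * b' z) (fun _ => 1) (fun z => a' z * b' z) (fun _ => 1)
  have v2 := hfour a' b' a' b'
  have v3 := hfour a' b' (fun z => a' z * b' z) (fun _ => 1)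
  simp only [mul_one, integral_const, probReal_univ, smul_eq_mul] at v1 v2 v3
  -- With J the mean of a'b' and F, G those of a', b', the three terms factor over independent
  -- copies as J², F²G² and FGJ, that is, as the expansion of (J - FG)².
  have key : ∫ z : Fin 4 → Z, ((a' (z 0) * a' (z 2)) * (b' (z 0) * b' (z 2)) +
      (a' (z 0) * a' (z 2)) * (b' (z 1) * b' (z 3)) -
      2 * ((a' (z 0) * a' (z 2)) * (b' (z 1) * b' (z 2)))) ∂(Measure.pi fun _ => μ) =
      (∫ z, a' z * b' z ∂μ - (∫ z, a' z ∂μ) * ∫ z, b' z ∂μ) ^ 2 := by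
    refine (integral_sub (i1.add i2) (i3.const_mul 2)).trans ?_
    rw [integral_const_mul]
    refine (congrArg (· - _) (integral_add i1 i2)).trans ?_
    have r1 : ∀ z : Fin 4 → Z, (a' (z 0) * a' (z 2)) * (b' (z 0) * b' (z 2)) =
      a' (z 0) * b' (z 0) * (a' (z 2) * b' (z 2)) := fun z => by ring
    have r2 : ∀ z : Fin 4 → Z, (a' (z 0) * a' (z 2)) * (b' (z 1) * b' (z 3)) =
      a' (z 0) * b' (z 1) * a' (z 2) * b' (z 3) := fun z => by ring
    have r3 : ∀ z : Fin 4 → Z, (a' (z 0) * a' (z 2)) * (b' (z 1) * b' (z 2)) =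
      a' (z 0) * b' (z 1) * (a' (z 2) * b' (z 2)) := fun z => by ring
    simp only [r1, r2, r3]
    rw [v1, v2, v3]
    ring
  exact key.symm

end Law

/-! ### Integral form equals explicit form for laws without atoms -/

section Continuous

variable {p q : ℕ}

/-- By Fubini: with one copy fixed, the other hits its value of f with probability zero. -/
theorem ae_pi_ne {Z T : Type*} [MeasurableSpace Z] (μ : Measure Z) [IsProbabilityMeasure μ]
    [MeasurableSpace T] [MeasurableEq T] {f : Z → T} (hf : Measurable f)
    (hμ : ∀ a, μ {z | f z = a} = 0) {m : ℕ} {i j : Fin m} (hij : i ≠ j) :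
    ∀ᵐ z ∂(Measure.pi fun _ : Fin m => μ), f (z i) ≠ f (z j) := by
  have hlaw : (Measure.pi fun _ : Fin m => μ).map (fun z => (z i, z j)) = μ.prod μ := by
    have h : iIndepFun (fun (i : Fin m) (z : Fin m → Z) => z i) (Measure.pi fun _ : Fin m => μ) :=
      iIndepFun_pi (μ := fun _ : Fin m => μ) (X := fun _ => id) (fun _ => aemeasurable_id)
    rw [(indepFun_iff_map_prod_eq_prod_map_map (measurable_pi_apply i).aemeasurable
      (measurable_pi_apply j).aemeasurable).1 (h.indepFun hij)]
    congr 1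
    · exact (measurePreserving_eval (fun _ : Fin m => μ) i).map_eq
    · exact (measurePreserving_eval (fun _ : Fin m => μ) j).map_eq
  have hs : MeasurableSet {t : Z × Z | f t.1 = f t.2} :=
    measurableSet_eq_fun (hf.comp measurable_fst) (hf.comp measurable_snd)
  have h0 : ∀ᵐ t ∂(μ.prod μ), f t.1 ≠ f t.2 := by
    rw [ae_iff]
    simp only [ne_eq, not_not]
    rw [Measure.measure_prod_null hs]
    refine Filter.Eventually.of_forall fun z => ?_
    refine Eq.trans ?_ (hμ (f z))
    exact congrArg μ (Set.ext fun t => eq_comm)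
  rw [← hlaw] at h0
  exact ae_of_ae_map ((measurable_pi_apply i).prodMk (measurable_pi_apply j)).aemeasurable h0

/-- The integral over all directions of the product of two indicators of half-spaces. -/
theorem integral_leInd_mul_leInd (hp : p ≠ 0) {u v w : E p} (hu : u ≠ w) (hv : v ≠ w) :
    ∫ α, leInd (inner ℝ (α : E p) u) (inner ℝ (α : E p) w) *
      leInd (inner ℝ (α : E p) v) (inner ℝ (α : E p) w) ∂(sphereMeasure p) =
      Real.pi - arccosAngle u v w := by
  classical
  rw [← sphereMeasure_le_and_le hp hu hv]
  simp only [leInd_mul_leInd]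
  have hm : ∀ u : E p, Measurable fun α : Metric.sphere (0 : E p) 1 => inner ℝ (α : E p) u :=
    fun u => by fun_prop
  exact integral_ite_one_zero _
    ((measurableSet_le (hm u) (hm w)).inter (measurableSet_le (hm v) (hm w)))

/-- Pointwise, reflecting all angles adds π(2b₃ - b₁ - b₂) to the kernel. Each bᵢ is an angle of
three distinct copies, so all three have the same mean and the addition integrates to zero. -/
theorem integral_pcovKernel_reflect (μ : Measure (E p × E q)) [IsProbabilityMeasure μ] :
    ∫ z : Fin 5 → E p × E q,
      (Real.pi - arccosAngle (z 0).1 (z 3).1 (z 2).1) *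
          (Real.pi - arccosAngle (z 0).2 (z 3).2 (z 2).2) +
        (Real.pi - arccosAngle (z 0).1 (z 3).1 (z 2).1) *
          (Real.pi - arccosAngle (z 1).2 (z 4).2 (z 2).2) -
        2 * ((Real.pi - arccosAngle (z 0).1 (z 3).1 (z 2).1) *
          (Real.pi - arccosAngle (z 1).2 (z 3).2 (z 2).2)) ∂(Measure.pi fun _ => μ) =
      ∫ z, pcovKernel z ∂(Measure.pi fun _ => μ) := by
  have hbm : Measurable fun z : Fin 3 → E p × E q => arccosAngle (z 0).2 (z 1).2 (z 2).2 :=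
    measurable_arccosAngle (measurable_pi_apply 0).snd (measurable_pi_apply 1).snd
      (measurable_pi_apply 2).snd
  have hb : ∀ i j k : Fin 5, Function.Injective ![i, j, k] →
      Integrable (fun z : Fin 5 → E p × E q => arccosAngle (z i).2 (z j).2 (z k).2)
        (Measure.pi fun _ => μ) ∧
      ∫ z : Fin 5 → E p × E q, arccosAngle (z i).2 (z j).2 (z k).2 ∂(Measure.pi fun _ => μ) =
      ∫ z : Fin 3 → E p × E q, arccosAngle (z 0).2 (z 1).2 (z 2).2 ∂(Measure.pi fun _ => μ) :=
    fun i j k h => by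
      constructor
      · exact Integrable.of_bound (C := Real.pi) (measurable_arccosAngle
          (measurable_pi_apply i).snd (measurable_pi_apply j).snd
          (measurable_pi_apply k).snd).aestronglyMeasurable
          (Filter.Eventually.of_forall fun z => abs_arccosAngle_le _ _ _)
      · rw [← map_pi_comp_injective μ h, integral_map (measurable_pi_lambda _ fun s =>
          measurable_pi_apply _).aemeasurable hbm.aestronglyMeasurable]
        rfl
  obtain ⟨i1, e1⟩ := hb 0 3 2 (by decide)
  obtain ⟨i2, e2⟩ := hb 1 4 2 (by decide)
  obtain ⟨i3, e3⟩ := hb 1 3 2 (by decide)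
  have hK : Integrable (pcovKernel (p := p) (q := q)) (Measure.pi fun _ => μ) :=
    Integrable.of_bound (C := M)
      (isVTerm_samplePcovTerm (n := 0)).measurable_kernel.aestronglyMeasurable
      (Filter.Eventually.of_forall fun z => (isVTerm_samplePcovTerm (n := 0)).abs_kernel_le z)
  have hzero : ∫ z : Fin 5 → E p × E q, Real.pi * (2 * arccosAngle (z 1).2 (z 3).2 (z 2).2 -
      arccosAngle (z 0).2 (z 3).2 (z 2).2 - arccosAngle (z 1).2 (z 4).2 (z 2).2)
      ∂(Measure.pi fun _ => μ) = 0 := by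
    rw [integral_const_mul]
    refine mul_eq_zero_of_right _ ?_
    refine (integral_sub ((i3.const_mul 2).sub i1) i2).trans ?_
    refine (congrArg (· - _) (integral_sub (i3.const_mul 2) i1)).trans ?_
    rw [integral_const_mul, e1, e2, e3]
    ring
  have hi : Integrable (fun z : Fin 5 → E p × E q => Real.pi * (2 *
      arccosAngle (z 1).2 (z 3).2 (z 2).2 - arccosAngle (z 0).2 (z 3).2 (z 2).2 -
      arccosAngle (z 1).2 (z 4).2 (z 2).2)) (Measure.pi fun _ => μ) :=
    (((i3.const_mul 2).sub i1).sub i2).const_mul _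
  rw [← add_zero (∫ z, pcovKernel z ∂(Measure.pi fun _ => μ)), ← hzero, ← integral_add hK hi]
  congr 1
  ext z
  unfold pcovKernel
  ring

/-- For continuous laws the integral definition of the squared projection covariance agrees with
the explicit form. -/
theorem pcovSq_eq_pcovSqExplicit {Ω : Type*} [MeasurableSpace Ω] (P : Measure Ω)
    [IsProbabilityMeasure P] {x : Ω → E p} {y : Ω → E q} (hx : AEMeasurable x P)
    (hy : AEMeasurable y P) (hxa : ∀ a, P {ω | x ω = a} = 0) (hyb : ∀ b, P {ω | y ω = b} = 0) :
    pcovSq P x y = pcovSqExplicit P x y := by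
  -- A law on the one-point space is an atom, so both dimensions are positive and both spheres have
  -- mass 2π.
  have hne : ∀ {r : ℕ} {f : Ω → E r}, (∀ a, P {ω | f ω = a} = 0) → r ≠ 0 := fun {r f} hf hr => by
    subst hr
    have := hf 0
    rw [show {ω | f ω = 0} = Set.univ from Set.eq_univ_of_forall fun ω => Subsingleton.elim _ _,
      measure_univ] at this
    exact one_ne_zero this
  have hp := hne hxa
  have hq := hne hyb
  have hxy : AEMeasurable (fun ω => (x ω, y ω)) P := hx.prodMk hy
  have hprob : IsProbabilityMeasure (P.map fun ω => (x ω, y ω)) :=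
    Measure.isProbabilityMeasure_map hxy
  rw [pcovSqExplicit_eq_integral_pcovKernel P hx hy]
  have hfst : ∀ a, (P.map fun ω => (x ω, y ω)) {z | z.1 = a} = 0 := fun a => by
    rw [Measure.map_apply_of_aemeasurable hxy
      (measurableSet_eq_fun measurable_fst measurable_const)]
    exact hxa a
  have hsnd : ∀ b, (P.map fun ω => (x ω, y ω)) {z | z.2 = b} = 0 := fun b => by
    rw [Measure.map_apply_of_aemeasurable hxy
      (measurableSet_eq_fun measurable_snd measurable_const)]
    exact hyb b
  have hcvm : ∀ (α : E p) (β : E q),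
      cvmDependence P (fun ω => inner ℝ α (x ω)) (fun ω => inner ℝ β (y ω)) = _ := fun α β =>
    (cvmDependence_eq_integral P hxy (f := fun z : E p × E q => inner ℝ α z.1)
      (g := fun z : E p × E q => inner ℝ β z.2) (by fun_prop) (by fun_prop) (fun _ => rfl)
      (fun _ => rfl)).trans
    (integral_sq_eq_integral_pi (P.map fun ω => (x ω, y ω))
      (a := fun z w : E p × E q => leInd (inner ℝ α z.1) (inner ℝ α w.1))
      (b := fun z w : E p × E q => leInd (inner ℝ β z.2) (inner ℝ β w.2))
      (measurable_leInd (by fun_prop) (by fun_prop)) (measurable_leInd (by fun_prop) (by fun_prop))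
      (fun _ _ => abs_leInd_le _ _) (fun _ _ => abs_leInd_le _ _))
  generalize (P.map fun ω => (x ω, y ω)) = μ at *
  unfold pcovSq
  simp only [hcvm]
  set A : Metric.sphere (0 : E p) 1 → E p → E p → E p → ℝ := fun α u v w =>
    leInd (inner ℝ (α : E p) u) (inner ℝ (α : E p) w) *
      leInd (inner ℝ (α : E p) v) (inner ℝ (α : E p) w) with hA
  set B : Metric.sphere (0 : E q) 1 → E q → E q → E q → ℝ := fun α u v w =>
    leInd (inner ℝ (α : E q) u) (inner ℝ (α : E q) w) *
      leInd (inner ℝ (α : E q) v) (inner ℝ (α : E q) w) with hB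
  set G : Metric.sphere (0 : E p) 1 × Metric.sphere (0 : E q) 1 → (Fin 5 → E p × E q) → ℝ :=
    fun γ z => A γ.1 (z 0).1 (z 3).1 (z 2).1 * B γ.2 (z 0).2 (z 3).2 (z 2).2 +
      A γ.1 (z 0).1 (z 3).1 (z 2).1 * B γ.2 (z 1).2 (z 4).2 (z 2).2 -
      2 * (A γ.1 (z 0).1 (z 3).1 (z 2).1 * B γ.2 (z 1).2 (z 3).2 (z 2).2) with hG
  change ∫ α, ∫ β, ∫ z, G (α, β) z ∂(Measure.pi fun _ => μ) ∂(sphereMeasure q) ∂(sphereMeasure p)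
    = _
  have hprod : ∀ {s t : ℝ}, |s| ≤ 1 → |t| ≤ 1 → |s * t| ≤ 1 := fun hs ht => by
    rw [abs_mul]
    exact mul_le_one₀ hs (abs_nonneg _) ht
  have hA1 : ∀ α u v w, |A α u v w| ≤ 1 := fun α u v w => hprod (abs_leInd_le _ _) (abs_leInd_le _ _)
  have hB1 : ∀ α u v w, |B α u v w| ≤ 1 := fun α u v w => hprod (abs_leInd_le _ _) (abs_leInd_le _ _)
  have hGb : ∀ γ z, |G γ z| ≤ 4 * 1 ^ 2 := fun γ z => abs_kernel_combination_le
    (hA1 _ _ _ _) (hB1 _ _ _ _) (hB1 _ _ _ _) (hB1 _ _ _ _)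
  have hAm : ∀ i j k : Fin 5, Measurable fun t : (Metric.sphere (0 : E p) 1 ×
      Metric.sphere (0 : E q) 1) × (Fin 5 → E p × E q) =>
      A t.1.1 (t.2 i).1 (t.2 j).1 (t.2 k).1 := fun i j k =>
    (measurable_leInd (by fun_prop) (by fun_prop)).mul
      (measurable_leInd (by fun_prop) (by fun_prop))
  have hBm : ∀ i j k : Fin 5, Measurable fun t : (Metric.sphere (0 : E p) 1 ×
      Metric.sphere (0 : E q) 1) × (Fin 5 → E p × E q) =>
      B t.1.2 (t.2 i).2 (t.2 j).2 (t.2 k).2 := fun i j k =>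
    (measurable_leInd (by fun_prop) (by fun_prop)).mul
      (measurable_leInd (by fun_prop) (by fun_prop))
  have hGm : Measurable (Function.uncurry G) :=
    (((hAm _ _ _).mul (hBm _ _ _)).add ((hAm _ _ _).mul (hBm _ _ _))).sub
      (((hAm _ _ _).mul (hBm _ _ _)).const_mul 2)
  have hGi : Integrable (Function.uncurry G)
      (((sphereMeasure p).prod (sphereMeasure q)).prod (Measure.pi fun _ => μ)) :=
    Integrable.of_bound (C := 4 * 1 ^ 2) hGm.aestronglyMeasurable
      (Filter.Eventually.of_forall fun t => hGb _ _)
  -- The two direction integrals are merged into one over the product of the spheres, which is then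
  -- exchanged with the expectation.
  refine (integral_prod (fun γ => ∫ z, G γ z ∂(Measure.pi fun _ => μ))
    hGi.integral_prod_left).symm.trans ?_
  rw [integral_integral_swap hGi, ← integral_pcovKernel_reflect]
  refine integral_congr_ae ?_
  -- The wedge formula needs the endpoints to differ from the vertex. Only the marginals have to be
  -- free of atoms, so the pairs (x, x) and (y, y) are covered too.
  have hx' : ∀ i : Fin 5, i ≠ 2 → ∀ᵐ z ∂(Measure.pi fun _ => μ), (z i).1 ≠ (z 2).1 := fun i hi =>
    ae_pi_ne μ measurable_fst hfst hi
  have hy' : ∀ i : Fin 5, i ≠ 2 → ∀ᵐ z ∂(Measure.pi fun _ => μ), (z i).2 ≠ (z 2).2 := fun i hi =>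
    ae_pi_ne μ measurable_snd hsnd hi
  filter_upwards [hx' 0 (by decide), hx' 3 (by decide), hy' 0 (by decide), hy' 1 (by decide),
    hy' 3 (by decide), hy' 4 (by decide)] with z x0 x3 y0 y1 y3 y4
  have hAi : ∀ u v w, Integrable (fun α => A α u v w) (sphereMeasure p) := fun u v w =>
    Integrable.of_bound (C := 1) ((measurable_leInd (by fun_prop) (by fun_prop)).mul
      (measurable_leInd (by fun_prop) (by fun_prop))).aestronglyMeasurable
      (Filter.Eventually.of_forall fun α => hA1 _ _ _ _)
  have hBi : ∀ u v w, Integrable (fun α => B α u v w) (sphereMeasure q) := fun u v w =>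
    Integrable.of_bound (C := 1) ((measurable_leInd (by fun_prop) (by fun_prop)).mul
      (measurable_leInd (by fun_prop) (by fun_prop))).aestronglyMeasurable
      (Filter.Eventually.of_forall fun α => hB1 _ _ _ _)
  have hABi : ∀ u v w u' v' w', Integrable (fun γ : Metric.sphere (0 : E p) 1 ×
      Metric.sphere (0 : E q) 1 => A γ.1 u v w * B γ.2 u' v' w')
      ((sphereMeasure p).prod (sphereMeasure q)) := fun u v w u' v' w' =>
    (hAi u v w).mul_prod (hBi u' v' w')
  refine (integral_sub ((hABi _ _ _ _ _ _).add (hABi _ _ _ _ _ _))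
    ((hABi _ _ _ _ _ _).const_mul 2)).trans ?_
  rw [integral_const_mul]
  refine (congrArg (· - _) (integral_add (hABi _ _ _ _ _ _) (hABi _ _ _ _ _ _))).trans ?_
  have hABv : ∀ u v w u' v' w', ∫ γ : Metric.sphere (0 : E p) 1 × Metric.sphere (0 : E q) 1,
      A γ.1 u v w * B γ.2 u' v' w' ∂((sphereMeasure p).prod (sphereMeasure q)) =
      (∫ α, A α u v w ∂(sphereMeasure p)) * ∫ β, B β u' v' w' ∂(sphereMeasure q) :=
    fun u v w u' v' w' => integral_prod_mul (fun α => A α u v w) (fun β => B β u' v' w')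
  simp only [hABv]
  rw [integral_leInd_mul_leInd hp x0 x3, integral_leInd_mul_leInd hq y0 y3,
    integral_leInd_mul_leInd hq y1 y4, integral_leInd_mul_leInd hq y1 y3]

end Continuous

end ProjCorr

/-! ### Assembly of the two claims -/

theorem theorem1 :
    ∃ c₁ c₂ : ℝ, 0 < c₁ ∧ 0 < c₂ ∧
      ∀ (p q n : ℕ)
        -- the population pair `(x, y)`
        (Ω : Type*) [MeasurableSpace Ω] (P : Measure Ω) [IsProbabilityMeasure P]
        (x : Ω → ProjCorr.E p) (y : Ω → ProjCorr.E q)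
        -- the sample: `n` independent copies of `(x, y)`
        (Ω' : Type*) [MeasurableSpace Ω'] (P' : Measure Ω') [IsProbabilityMeasure P']
        (X : Fin n → Ω' → ProjCorr.E p) (Y : Fin n → Ω' → ProjCorr.E q)
        (_ : iIndepFun (fun i ω => (X i ω, Y i ω)) P')
        (_ : ∀ i, IdentDistrib (fun ω => (X i ω, Y i ω)) (fun ω => (x ω, y ω)) P' P)
        (_ : AEMeasurable x P) (_ : AEMeasurable y P)
        (ε : ℝ) (_ : 0 < ε) (_ : ε < 1) (_ : 10 * Real.pi ^ 2 / ε ≤ n),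
        -- continuous marginals: the integral definition of the projection covariance
        ((∀ a, P {ω | x ω = a} = 0) → (∀ b, P {ω | y ω = b} = 0) →
          P'.real {ω | ε < |ProjCorr.samplePcovSq (fun i => X i ω) (fun i => Y i ω)
              - ProjCorr.pcovSq P x y|}
            ≤ c₁ * Real.exp (-(c₂ * n * ε ^ 2)) ∧
          P'.real {ω | ε < |ProjCorr.corrSq
                (ProjCorr.samplePcovSq (fun i => X i ω) (fun i => Y i ω))
                (ProjCorr.samplePcovSq (fun i => X i ω) (fun i => X i ω))
                (ProjCorr.samplePcovSq (fun i => Y i ω) (fun i => Y i ω))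
              - ProjCorr.corrSq (ProjCorr.pcovSq P x y) (ProjCorr.pcovSq P x x)
                (ProjCorr.pcovSq P y y)|}
            ≤ 5 * c₁ * Real.exp (-(c₂ *
                ProjCorr.sigma (ProjCorr.pcovSq P x x) (ProjCorr.pcovSq P y y) * n * ε ^ 2))) ∧
        -- arbitrary laws: the explicit form of the projection covariance
        (P'.real {ω | ε < |ProjCorr.samplePcovSq (fun i => X i ω) (fun i => Y i ω)
              - ProjCorr.pcovSqExplicit P x y|}
            ≤ c₁ * Real.exp (-(c₂ * n * ε ^ 2)) ∧
          P'.real {ω | ε < |ProjCorr.corrSq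
                (ProjCorr.samplePcovSq (fun i => X i ω) (fun i => Y i ω))
                (ProjCorr.samplePcovSq (fun i => X i ω) (fun i => X i ω))
                (ProjCorr.samplePcovSq (fun i => Y i ω) (fun i => Y i ω))
              - ProjCorr.corrSq (ProjCorr.pcovSqExplicit P x y) (ProjCorr.pcovSqExplicit P x x)
                (ProjCorr.pcovSqExplicit P y y)|}
            ≤ 5 * c₁ * Real.exp (-(c₂ *
                ProjCorr.sigma (ProjCorr.pcovSqExplicit P x x) (ProjCorr.pcovSqExplicit P y y)
                  * n * ε ^ 2))) := by
  -- The factor 2 is the two-sided McDiarmid bound; c₂ is the `V`-statistic rate with B = M.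
  refine ⟨2, (800 * ProjCorr.M ^ 2)⁻¹, two_pos,
    inv_pos.2 (mul_pos (by norm_num) (pow_pos ProjCorr.M_pos 2)), ?_⟩
  intro p q n Ω _ P _ x y Ω' _ P' _ X Y hindep hident hx hy ε hε _ hnε
  have hn : n ≠ 0 := by
    rintro rfl
    have : 0 < 10 * Real.pi ^ 2 / ε := by positivity
    rw [Nat.cast_zero] at hnε
    linarith
  have hcov := ProjCorr.measureReal_samplePcovSq_sub_gt_le hn hindep hident hx hy hε
  have hcorr := ProjCorr.measureReal_corrSq_sub_gt_le hn hindep hident hx hy hε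
  refine ⟨fun hxa hyb => ?_, hcov, hcorr⟩
  rw [ProjCorr.pcovSq_eq_pcovSqExplicit P hx hy hxa hyb,
    ProjCorr.pcovSq_eq_pcovSqExplicit P hx hx hxa hxa,
    ProjCorr.pcovSq_eq_pcovSqExplicit P hy hy hyb hyb]
  exact ⟨hcov, hcorr⟩
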